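/- **Conventions.** All norms are Euclidean. A subset $\mathcal D\subset\mathbb Z^2$ has the *$2\mathbb Z$-property* if it contains all $(m,n)\in\mathbb Z^2$ with $m$ even; a subset of a box of $\mathbb Z^2$ has it if it contains all points $(m,n)$ of the box with $m$ even. A map $f:\mathcal D\to\mathbb Z^2$ is *$L$-bi-Lipschitz* if $\|x-y\|/L\le\|f(x)-f(y)\|\le L\|x-y\|$ for all $x,y\in\mathcal D$. A *square patch of side $2M$* ($M\ge1$) is a subset of $[-M,M]^2\cap\mathbb Z^2$; its *density* is the number of its points in $[-M,M-1]^2$ divided by $(2M)^2$. A set $\mathcal D$ *contains a translated copy* of it if, for some $v\in\mathbb Z^2$, the part of $\mathcal D$ in $v+[-M,M]^2$ is exactly the translate of the patch by $v$. **Construction.** Let $\mathcal A,\mathcal B$ be square patches of side $2M$, and let $K,N\ge1$ be integers. The patch $W_{K,N}(\mathcal A,\mathcal B)$ of side $2MK(2N+1)$ is the square of $K(2N+1)\times K(2N+1)$ copies of $\mathcal A$ and $\mathcal B$, neighbouring copies being matched along common sides, in which the lowest $K$ rows of copies form a row of $2N+1$ blocks of $K\times K$ copies, alternately of $\mathcal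 A$ and of $\mathcal B$, the central block being made of copies of $\mathcal A$, and in which all other copies are copies of $\mathcal A$. **Constants.** Given $L\ge1$ and $1\ge d>d'>0$, we say that a real $\lambda>0$ and positive integers $M_*,N_*,P_*$ *force expansion* for $(L,d,d')$ if the following holds for every Delone set $\mathcal D\subset\mathbb Z^2$ with the $2\mathbb Z$-property, every surjective $L$-bi-Lipschitz map $f:\mathcal D\to\mathbb Z^2$, every multiple $M\ge M_*$ of $2P_*$ and every $N\ge N_*$. Put $c_k=|\mathcal D\cap([(k-1)M,kM-1]\times[0,M-1])|$, and suppose that for every $1\le k<2N$ one of $c_k,c_{k+1}$ is $\ge dM^2$ and the other is $\le d'M^2$. Then there are integers $1\le k\le 2N$, $0\le i<P_*$, $0\le j\le P_*$ such that the point $x=\big((k-1)M+i\frac M{P_*},\,j\frac M{P_*}\big)$ satisfies $$\frac{\|f(x+(M/P_*,0))-f(x)\|}{M/P_*}\ \ge\ (1+\lambda)\,\frac{\|f(2MN,0)-f(0,0)\|}{2MN}.$$ (All points at which $f$ is evaluated here have even first coordinate, so they belong to $\mathcal D$.) **Lemma.** Let $L\ge1$ and $1\ge d_2'>d_1'>0$.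 There exist a real $\lambda>0$ and positive integers $M_*,N_*,P_*$, depending only on $L,d_1',d_2'$, that force expansion for $(L,d_2',d_1')$ and for which the following holds. Let $\mathcal Q_1,\mathcal Q_2$ be square patches of the same side $2M_0>0$ that contain all boundary points of $[-M_0,M_0]^2\cap\mathbb Z^2$, have the $2\mathbb Z$-property, and have densities $d_1<d_1'$ and $d_2>d_2'$, respectively. Let $\ell\ge1$ be an integer with $(1+\lambda)^\ell/L>L$. Put $\mathcal Q_i^0=\mathcal Q_i$ and, for $0\le s<\ell$, $$\mathcal Q_1^{s+1}=W_{m_sP_*,N_s}(\mathcal Q_1^s,\mathcal Q_2^s),\qquad \mathcal Q_2^{s+1}=W_{m_sP_*,N_s}(\mathcal Q_2^s,\mathcal Q_1^s),$$ where, with $2M_s$ the side of $\mathcal Q_i^s$, the integer $m_s\ge 1$ is odd with $2m_sP_*M_s\ge M_*$, and $N_s\ge N_*$ is such that the density of $\mathcal Q_1^{s+1}$ is $<d_1'$ and that of $\mathcal Q_2^{s+1}$ is $>d_2'$. Write $\mathcal Q_i^{new}=\mathcal Q_i^{\ell}$. If $\mathcal D\subset\mathbb Z^2$ is a Delone set with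 the $2\mathbb Z$-property that contains a translated copy of $\mathcal Q_1^{new}$ or of $\mathcal Q_2^{new}$, then there is no surjective $L$-bi-Lipschitz map $\mathcal D\to\mathbb Z^2$. -/

import Mathlib

/-- The point of the Euclidean plane with the given integer coordinates. -/
noncomputable def latticePoint (p : ℤ × ℤ) : EuclideanSpace ℝ (Fin 2) :=
  !₂[(p.1 : ℝ), (p.2 : ℝ)]

/-- The Euclidean norm of an integer vector. -/
noncomputable def euclNorm (p : ℤ × ℤ) : ℝ := ‖latticePoint p‖

/-- A set of integer points that is a Delone set of the Euclidean plane. -/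
def IsDelone (D : Set (ℤ × ℤ)) : Prop :=
  ∃ E : Delone.DeloneSet (EuclideanSpace ℝ (Fin 2)), E.carrier = latticePoint '' D

/-- The `2ℤ`-property of a subset `D` of the integer points of a region `B`: every point of `B`
with even first coordinate belongs to `D`. -/
def TwoZProperty (B D : Set (ℤ × ℤ)) : Prop :=
  ∀ p ∈ B, Even p.1 → p ∈ D

/-- `f` is an `L`-bi-Lipschitz map from `D` to the integer lattice, for the Euclidean distance. -/
def IsBiLipschitzMap (L : ℝ) {D : Set (ℤ × ℤ)} (f : D → ℤ × ℤ) : Prop :=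
  ∀ x y : D, euclNorm (x.1 - y.1) / L ≤ euclNorm (f x - f y) ∧
    euclNorm (f x - f y) ≤ L * euclNorm (x.1 - y.1)

/-- The number of points of `D` in the lower-left corner
`{(k-1)M, …, kM-1} × {0, …, M-1}` of the `k`-th square of side `M`, counted from `k = 1`,
of the rectangle `[0, 2MN] × [0, M]`. -/
noncomputable def cornerCount (D : Set (ℤ × ℤ)) (M k : ℕ) : ℕ :=
  (D ∩ Set.Ico (((k : ℤ) - 1) * M) (k * M) ×ˢ Set.Ico (0 : ℤ) M).ncard

/-- The constants `lam, Ms, Ns, Ps` force expansion for `L`-bi-Lipschitz surjections and the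
densities `d > d'`: if a Delone set with the `2ℤ`-property has, in any two consecutive squares of
side `M` of the rectangle `[0, 2MN] × [0, M]`, at least `d M ^ 2` points in the lower-left corner
of one and at most `d' M ^ 2` points in that of the other, then some horizontal step of length
`M / Ps` between grid points of the rectangle is expanded, by a factor at least `1 + lam`, more
than the lower side of the rectangle. As `M / Ps` is even, all these grid points lie in `D`. -/
def ForcesExpansion (L d d' lam : ℝ) (Ms Ns Ps : ℕ) : Prop :=
  ∀ (D : Set (ℤ × ℤ)) (f : D → ℤ × ℤ), IsDelone D → TwoZProperty Set.univ D →
    IsBiLipschitzMap L f → Function.Surjective f →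
    ∀ M N : ℕ, Ms ≤ M → Ns ≤ N → 2 * Ps ∣ M →
      (∀ k : ℕ, 1 ≤ k → k < 2 * N →
        (d * (M : ℝ) ^ 2 ≤ cornerCount D M k ∧ (cornerCount D M (k + 1) : ℝ) ≤ d' * (M : ℝ) ^ 2) ∨
        ((cornerCount D M k : ℝ) ≤ d' * (M : ℝ) ^ 2 ∧
          d * (M : ℝ) ^ 2 ≤ cornerCount D M (k + 1))) →
      ∃ x y o e : D, ∃ k i j : ℕ, 1 ≤ k ∧ k ≤ 2 * N ∧ i < Ps ∧ j ≤ Ps ∧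
        x.1 = (((k : ℤ) - 1) * M + i * (M / Ps : ℕ), (j : ℤ) * (M / Ps : ℕ)) ∧
        y.1 = x.1 + (((M / Ps : ℕ) : ℤ), 0) ∧
        o.1 = (0, 0) ∧ e.1 = (2 * (M : ℤ) * N, 0) ∧
        (1 + lam) * (euclNorm (f e - f o) / (2 * M * N : ℝ)) ≤
          euclNorm (f y - f x) / ((M : ℝ) / Ps)

/-- The integer points of the square `[-M, M] × [-M, M]`. -/
def box (M : ℕ) : Set (ℤ × ℤ) := Set.Icc (-(M : ℤ)) M ×ˢ Set.Icc (-(M : ℤ)) M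

/-- The density of points of the patch `Q` of side `2M`, centered at the origin, in its lower-left
corner, that is, in the square without its upper and right sides. -/
noncomputable def patchDensity (M : ℕ) (Q : Set (ℤ × ℤ)) : ℝ :=
  ((Q ∩ Set.Ico (-(M : ℤ)) M ×ˢ Set.Ico (-(M : ℤ)) M).ncard : ℝ) / (2 * (M : ℝ)) ^ 2

/-- A square patch of side `2M`, centered at the origin, which contains all the boundary points of
its square and has the `2ℤ`-property. -/
structure IsInitialPatch (M : ℕ) (Q : Set (ℤ × ℤ)) : Prop where
  subset_box : Q ⊆ box M
  boundary : ∀ p ∈ box M, |p.1| = M ∨ |p.2| = M → p ∈ Q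
  twoZ : TwoZProperty (box M) Q

/-- Two sets of integer points, regarded as square patches of the same side `2 * half`, centered
at the origin. -/
structure PatchPair where
  half : ℕ
  one : Set (ℤ × ℤ)
  two : Set (ℤ × ℤ)

/-- The square patch centered at the origin made of `n × n` copies of patches of side `2M`, where
`n = K (2N + 1)`; consecutive copies share a side. The copies are indexed by column `a` and row
`b`, from the lower left. The lowest `K` rows consist of `2N + 1` blocks of `K × K` copies,
alternately of `A` and of `B`, with copies of `A` in the central block, which has index `N` when
the blocks are numbered from `0`. All other copies are copies of `A`. -/
def blockPatch (M K N : ℕ) (A B : Set (ℤ × ℤ)) : Set (ℤ × ℤ) :=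
  {p | ∃ a b : ℕ, a < K * (2 * N + 1) ∧ b < K * (2 * N + 1) ∧
    ((b < K ∧ Odd (a / K + N) ∧
        p - ((2 * (a : ℤ) + 1 - K * (2 * N + 1)) * M, (2 * (b : ℤ) + 1 - K * (2 * N + 1)) * M) ∈ B) ∨
      (¬ (b < K ∧ Odd (a / K + N)) ∧
        p - ((2 * (a : ℤ) + 1 - K * (2 * N + 1)) * M, (2 * (b : ℤ) + 1 - K * (2 * N + 1)) * M) ∈ A))}

/-- One step of the construction, from a pair of patches to a pair of patches whose side is
`K (2N + 1)` times as long. -/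
def PatchPair.next (Q : PatchPair) (K N : ℕ) : PatchPair where
  half := K * (2 * N + 1) * Q.half
  one := blockPatch Q.half K N Q.one Q.two
  two := blockPatch Q.half K N Q.two Q.one

/-- The pair of patches after `s` steps; step number `t` uses blocks of `(m t * P) ^ 2` copies and
`N t` blocks on either side of the central one. -/
def PatchPair.iter (Q : PatchPair) (P : ℕ) (m N : ℕ → ℕ) : ℕ → PatchPair
  | 0 => Q
  | s + 1 => (Q.iter P m N s).next (m s * P) (N s)

/-- `D` contains a translated copy of the patch `Q` of side `2M`: in some translate of the square,
`D` coincides with the translate of `Q`. -/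
def ContainsPatch (D : Set (ℤ × ℤ)) (M : ℕ) (Q : Set (ℤ × ℤ)) : Prop :=
  ∃ v : ℤ × ℤ, {p | p ∈ box M ∧ p + v ∈ D} = Q

/-!
The proof combines the Burago–Kleiner expansion argument with its iteration through scales.

*Expansion.* Cut a strip into `2N` squares of side `M`, alternately dense and sparse in `D`, and
suppose that no horizontal step of length `M / P` of the grid is expanded by more than `1 + lam` times
the average expansion of the lower side. Each row of the grid is then mapped to a chain of nearly
maximal total length in a direction common to all rows. By averaging over pairs of consecutive
squares (`exists_block_steps_near`) all steps in some pair nearly equal one fixed vector, so that on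
one square the map nearly differs by a translation from the map on the next
(`IsBiLipschitzSurjOn.exists_nearly_translated_squares`). Since the map is a bi-Lipschitz bijection
onto the lattice, translating the values on one square gives values at points near the other one,
and the two squares have nearly the same number of points
(`IsBiLipschitzSurjOn.ncard_inter_cell_le`). This contradicts the gap between the densities. As the
grid also fills the interior of the squares, nothing is needed about the topology of the plane.
The argument uses no points of `D` beyond the grid points and those counted.

*Iteration.* The patches contain the boundaries of their squares, so a copy of a patch in `D` is made
of copies of the patches of the previous level, and their corners lie in `D` whatever their parity.
If the lower side of a copy is expanded by `E`, the expansion argument, applied to the first `2N` of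
the `2N + 1` blocks along this side, gives a step expanded by `(1 + 2 * lam) * E`, up to a loss of order
`1 / N` caused by the missing block; hence by `(1 + lam) * E` if `N` is large. This step is a chain of
lower sides of smaller copies, one of which is expanded at least as much
(`IsBiLipschitzSurjOn.exists_expanded_copy`). Starting from an expansion `1 / L` at level `l`, the
initial patches are reached with an expansion `(1 + lam) ^ l / L > L`, which is absurd.
-/

/-! ### Integer vectors and their Euclidean norm -/

lemma latticePoint_add (p q : ℤ × ℤ) :
    latticePoint (p + q) = latticePoint p + latticePoint q := by
  ext i; fin_cases i <;> simp [latticePoint]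

lemma latticePoint_sub (p q : ℤ × ℤ) :
    latticePoint (p - q) = latticePoint p - latticePoint q := by
  ext i; fin_cases i <;> simp [latticePoint]

lemma euclNorm_eq_sqrt (p : ℤ × ℤ) :
    euclNorm p = Real.sqrt ((p.1 : ℝ) ^ 2 + (p.2 : ℝ) ^ 2) := by
  simp [euclNorm, latticePoint, EuclideanSpace.norm_eq, Fin.sum_univ_two]

lemma abs_fst_le_euclNorm (p : ℤ × ℤ) : |(p.1 : ℝ)| ≤ euclNorm p := by
  rw [euclNorm_eq_sqrt]
  exact Real.abs_le_sqrt (by nlinarith [sq_nonneg (p.2 : ℝ)])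

lemma abs_snd_le_euclNorm (p : ℤ × ℤ) : |(p.2 : ℝ)| ≤ euclNorm p := by
  rw [euclNorm_eq_sqrt]
  exact Real.abs_le_sqrt (by nlinarith [sq_nonneg (p.1 : ℝ)])

lemma norm_plane_le_abs_add_abs (x : EuclideanSpace ℝ (Fin 2)) : ‖x‖ ≤ |x 0| + |x 1| := by
  rw [EuclideanSpace.norm_eq, Fin.sum_univ_two]
  refine Real.sqrt_le_iff.2 ⟨by positivity, ?_⟩
  simp only [Real.norm_eq_abs]
  nlinarith [abs_nonneg (x 0), abs_nonneg (x 1)]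

lemma euclNorm_le_abs_add_abs (p : ℤ × ℤ) : euclNorm p ≤ |(p.1 : ℝ)| + |(p.2 : ℝ)| := by
  simpa [latticePoint, euclNorm] using norm_plane_le_abs_add_abs (latticePoint p)

lemma euclNorm_horizontal (a : ℤ) : euclNorm (a, 0) = |(a : ℝ)| := by
  simp [euclNorm_eq_sqrt, Real.sqrt_sq_eq_abs]

lemma euclNorm_vertical (a : ℤ) : euclNorm (0, a) = |(a : ℝ)| := by
  simp [euclNorm_eq_sqrt, Real.sqrt_sq_eq_abs]

/-- Every vector of the plane is at distance at most `1` from an integer vector. -/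
lemma exists_norm_latticePoint_sub_le_one (v : EuclideanSpace ℝ (Fin 2)) :
    ∃ w : ℤ × ℤ, ‖latticePoint w - v‖ ≤ 1 := by
  refine ⟨(round (v 0), round (v 1)), ?_⟩
  have h0 := abs_sub_round (v 0)
  have h1 := abs_sub_round (v 1)
  rw [abs_sub_comm] at h0 h1
  refine (norm_plane_le_abs_add_abs _).trans ?_
  simp only [latticePoint, PiLp.sub_apply, Matrix.cons_val_zero, Matrix.cons_val_one]
  linarith

/-- A bi-Lipschitz surjection of `D` onto the integer lattice, extended to the whole lattice by
arbitrary values outside `D`. -/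
structure IsBiLipschitzSurjOn (L : ℝ) (D : Set (ℤ × ℤ)) (F : ℤ × ℤ → ℤ × ℤ) : Prop where
  one_le : 1 ≤ L
  lower : ∀ x ∈ D, ∀ y ∈ D, euclNorm (x - y) ≤ L * euclNorm (F x - F y)
  upper : ∀ x ∈ D, ∀ y ∈ D, euclNorm (F x - F y) ≤ L * euclNorm (x - y)
  surj : Set.SurjOn F D Set.univ

open Classical in
lemma IsBiLipschitzMap.exists_isBiLipschitzSurjOn {L : ℝ} {D : Set (ℤ × ℤ)} {f : D → ℤ × ℤ}
    (hL : 1 ≤ L) (hf : IsBiLipschitzMap L f) (hs : Function.Surjective f) :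
    ∃ F : ℤ × ℤ → ℤ × ℤ, IsBiLipschitzSurjOn L D F ∧ ∀ x : D, F x = f x := by
  have key (x : D) : (fun p => if hp : p ∈ D then f ⟨p, hp⟩ else 0) x.1 = f x := by simp
  refine ⟨fun p => if hp : p ∈ D then f ⟨p, hp⟩ else 0, ⟨hL, ?_, ?_, ?_⟩, key⟩
  · intro x hx y hy
    simp only [hx, hy, dif_pos]
    have := (hf ⟨x, hx⟩ ⟨y, hy⟩).1
    rwa [div_le_iff₀ (by linarith), mul_comm] at this
  · intro x hx y hy
    simp only [hx, hy, dif_pos]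
    exact (hf ⟨x, hx⟩ ⟨y, hy⟩).2
  · intro z _
    obtain ⟨x, hx⟩ := hs z
    exact ⟨x, x.2, by rw [← hx]; exact key x⟩

lemma IsBiLipschitzSurjOn.injOn {L : ℝ} {D : Set (ℤ × ℤ)} {F : ℤ × ℤ → ℤ × ℤ}
    (hF : IsBiLipschitzSurjOn L D F) : Set.InjOn F D := by
  intro x hx y hy h
  have h1 := hF.lower x hx y hy
  have h0 : euclNorm (F x - F y) = 0 := by simp [h, euclNorm_eq_sqrt]
  rw [h0, mul_zero] at h1
  have ha := (abs_fst_le_euclNorm (x - y)).trans h1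
  have hb := (abs_snd_le_euclNorm (x - y)).trans h1
  rw [abs_nonpos_iff] at ha hb
  rw [← sub_eq_zero]
  exact Prod.ext (by exact_mod_cast ha) (by exact_mod_cast hb)

/-! ### Counting points in squares -/

/-- The half-open square of side `M` with lower-left corner `o`. -/
def cell (o : ℤ × ℤ) (M : ℕ) : Set (ℤ × ℤ) :=
  Set.Ico o.1 (o.1 + M) ×ˢ Set.Ico o.2 (o.2 + M)

lemma mem_cell {o p : ℤ × ℤ} {M : ℕ} :
    p ∈ cell o M ↔ (o.1 ≤ p.1 ∧ p.1 < o.1 + M) ∧ (o.2 ≤ p.2 ∧ p.2 < o.2 + M) := by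
  simp [cell, Set.mem_prod]

lemma cell_eq_coe_finset (o : ℤ × ℤ) (M : ℕ) :
    cell o M = ↑(Finset.Ico o.1 (o.1 + M) ×ˢ Finset.Ico o.2 (o.2 + M)) := by
  simp [cell]

lemma finite_cell (o : ℤ × ℤ) (M : ℕ) : (cell o M).Finite := by
  rw [cell_eq_coe_finset]; exact Finset.finite_toSet _

lemma ncard_cell (o : ℤ × ℤ) (M : ℕ) : (cell o M).ncard = M * M := by
  rw [cell_eq_coe_finset, Set.ncard_coe_finset, Finset.card_product]
  simp

lemma ncard_inter_cell_enlarged_le (D : Set (ℤ × ℤ)) (o : ℤ × ℤ) (M T : ℕ) :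
    (D ∩ cell (o - ((T : ℤ), (T : ℤ))) (M + 2 * T)).ncard ≤
      (D ∩ cell o M).ncard + (4 * T * M + 4 * T * T) := by
  have hsub : cell o M ⊆ cell (o - ((T : ℤ), (T : ℤ))) (M + 2 * T) := by
    intro p hp
    rw [mem_cell] at hp ⊢
    push_cast
    simp only [Prod.fst_sub, Prod.snd_sub]
    omega
  have hd := Set.ncard_sdiff_add_ncard_of_subset hsub (finite_cell _ _)
  rw [ncard_cell, ncard_cell] at hd
  have h1 : (D ∩ cell (o - ((T : ℤ), (T : ℤ))) (M + 2 * T)).ncard ≤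
      ((D ∩ cell o M) ∪ (cell (o - ((T : ℤ), (T : ℤ))) (M + 2 * T) \ cell o M)).ncard := by
    refine Set.ncard_le_ncard ?_
      (((finite_cell _ _).subset Set.inter_subset_right).union ((finite_cell _ _).sdiff))
    intro p hp
    by_cases h : p ∈ cell o M
    · exact Or.inl ⟨hp.1, h⟩
    · exact Or.inr ⟨hp.2, h⟩
  have h2 := Set.ncard_union_le (D ∩ cell o M)
    (cell (o - ((T : ℤ), (T : ℤ))) (M + 2 * T) \ cell o M)
  nlinarith

/-- If a bi-Lipschitz bijection onto the lattice takes on the square at `b` nearly the values it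
takes on the square at `a`, up to a translation `v`, then the square at `a` has few more points than
the one at `b`: by surjectivity every translated value is a value, and by the lower Lipschitz bound
it is taken near the square at `b`. -/
lemma IsBiLipschitzSurjOn.ncard_inter_cell_le {L : ℝ} {D : Set (ℤ × ℤ)} {F : ℤ × ℤ → ℤ × ℤ}
    (hF : IsBiLipschitzSurjOn L D F) (a b : ℤ × ℤ) (h P : ℕ) (hh : 0 < h)
    (v : EuclideanSpace ℝ (Fin 2))
    (ha : ∀ i < P, ∀ j < P, a + ((i : ℤ) * h, (j : ℤ) * h) ∈ D)
    (hb : ∀ i < P, ∀ j < P, b + ((i : ℤ) * h, (j : ℤ) * h) ∈ D)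
    (hv : ∀ i < P, ∀ j < P, ‖latticePoint (F (b + ((i : ℤ) * h, (j : ℤ) * h))) -
      latticePoint (F (a + ((i : ℤ) * h, (j : ℤ) * h))) - v‖ ≤ L * h) :
    ((D ∩ cell a (P * h)).ncard : ℝ) ≤ (D ∩ cell b (P * h)).ncard +
      (4 * (4 * L ^ 2 * h) * (P * h) + 4 * (4 * L ^ 2 * h) ^ 2) := by
  obtain ⟨w, hw⟩ := exists_norm_latticePoint_sub_le_one v
  set T : ℕ := ⌊4 * L ^ 2 * h⌋₊ with hT
  have hTle : (T : ℝ) ≤ 4 * L ^ 2 * h := Nat.floor_le (by positivity)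
  have hL := hF.one_le
  have hh1 : (1 : ℝ) ≤ h := by exact_mod_cast hh
  choose y hyD hy using fun x => hF.surj (Set.mem_univ (F x + w))
  have hmaps : ∀ x ∈ D ∩ cell a (P * h),
      y x ∈ D ∩ cell (b - ((T : ℤ), (T : ℤ))) (P * h + 2 * T) := by
    rintro x ⟨hxD, hx⟩
    refine ⟨hyD x, ?_⟩
    rw [mem_cell] at hx
    have hh' : (0 : ℤ) < h := by exact_mod_cast hh
    -- the lower-left corner of the square of the grid of mesh `h` that contains `x`
    have grid : ∀ t : ℤ, 0 ≤ t → t < ((P * h : ℕ) : ℤ) →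
        ∃ i < P, (i : ℤ) * h ≤ t ∧ t < (i : ℤ) * h + h := by
      intro t h0 h1
      have e1 := Int.emod_nonneg t hh'.ne'
      have e2 := Int.emod_lt_of_pos t hh'
      have e3 := Int.mul_ediv_add_emod t h
      have e4 : 0 ≤ t / h := Int.ediv_nonneg h0 hh'.le
      have e5 : t / h < P := Int.ediv_lt_of_lt_mul hh' (by exact_mod_cast h1)
      refine ⟨(t / h).toNat, by omega, ?_, ?_⟩ <;> rw [Int.toNat_of_nonneg e4] <;> nlinarith
    obtain ⟨i, hi, hi1, hi2⟩ := grid (x.1 - a.1) (by omega) (by omega)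
    obtain ⟨j, hj, hj1, hj2⟩ := grid (x.2 - a.2) (by omega) (by omega)
    have hdist : euclNorm (x - (a + ((i : ℤ) * h, (j : ℤ) * h))) ≤ 2 * h := by
      refine (euclNorm_le_abs_add_abs _).trans ?_
      have e1 : |x.1 - (a.1 + (i : ℤ) * h)| ≤ h := by rw [abs_le]; constructor <;> linarith
      have e2 : |x.2 - (a.2 + (j : ℤ) * h)| ≤ h := by rw [abs_le]; constructor <;> linarith
      have e1' : |((x.1 - (a.1 + (i : ℤ) * h) : ℤ) : ℝ)| ≤ h := by exact_mod_cast e1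
      have e2' : |((x.2 - (a.2 + (j : ℤ) * h) : ℤ) : ℝ)| ≤ h := by exact_mod_cast e2
      simp only [Prod.fst_sub, Prod.snd_sub, Prod.fst_add, Prod.snd_add]
      linarith
    have hu := hF.upper x hxD _ (ha i hi j hj)
    have hu' : euclNorm (F x - F (a + ((i : ℤ) * h, (j : ℤ) * h))) ≤ L * (2 * h) :=
      hu.trans (by gcongr)
    have hclose : euclNorm (F (y x) - F (b + ((i : ℤ) * h, (j : ℤ) * h))) ≤ 4 * L * h := by
      have hv' := hv i hi j hj
      rw [hy x]
      unfold euclNorm at hu' ⊢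
      rw [latticePoint_sub] at hu' ⊢
      rw [latticePoint_add]
      set fa := latticePoint (F (a + ((i : ℤ) * h, (j : ℤ) * h)))
      set fb := latticePoint (F (b + ((i : ℤ) * h, (j : ℤ) * h)))
      have e : latticePoint (F x) + latticePoint w - fb =
          (latticePoint (F x) - fa) - (fb - fa - v) + (latticePoint w - v) := by abel
      rw [e]
      have t1 := norm_add_le (latticePoint (F x) - fa - (fb - fa - v)) (latticePoint w - v)
      have t2 := norm_sub_le (latticePoint (F x) - fa) (fb - fa - v)
      nlinarith
    have hl : euclNorm (y x - (b + ((i : ℤ) * h, (j : ℤ) * h))) ≤ 4 * L ^ 2 * h := by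
      refine (hF.lower _ (hyD x) _ (hb i hi j hj)).trans ?_
      nlinarith
    have bound : ∀ t : ℤ, |(t : ℝ)| ≤ euclNorm (y x - (b + ((i : ℤ) * h, (j : ℤ) * h))) →
        |t| ≤ T := by
      intro t ht
      have : ((t.natAbs : ℕ) : ℝ) ≤ 4 * L ^ 2 * h := by
        rw [Nat.cast_natAbs, Int.cast_abs]; exact ht.trans hl
      have := Nat.le_floor this
      rw [Int.abs_eq_natAbs]
      exact_mod_cast this
    have b1 := bound _ (abs_fst_le_euclNorm _)
    have b2 := bound _ (abs_snd_le_euclNorm _)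
    rw [abs_le] at b1 b2
    simp only [Prod.fst_sub, Prod.snd_sub, Prod.fst_add, Prod.snd_add] at b1 b2
    have hi3 : (i : ℤ) * h + h ≤ P * h := by
      have : (i : ℤ) + 1 ≤ P := by exact_mod_cast hi
      nlinarith
    have hj3 : (j : ℤ) * h + h ≤ P * h := by
      have : (j : ℤ) + 1 ≤ P := by exact_mod_cast hj
      nlinarith
    have hi4 : (0 : ℤ) ≤ i * h := by positivity
    have hj4 : (0 : ℤ) ≤ j * h := by positivity
    rw [mem_cell]
    push_cast
    simp only [Prod.fst_sub, Prod.snd_sub]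
    refine ⟨⟨?_, ?_⟩, ?_, ?_⟩ <;> linarith
  have hinj : Set.InjOn y (D ∩ cell a (P * h)) := by
    intro x hx x' hx' hxx
    have h1 := hy x
    rw [hxx, hy x'] at h1
    exact hF.injOn hx.1 hx'.1 (add_right_cancel h1).symm
  have h1 := Set.ncard_le_ncard_of_injOn y hmaps hinj
    ((finite_cell _ _).subset Set.inter_subset_right)
  have h2 := h1.trans (ncard_inter_cell_enlarged_le D b (P * h) T)
  have h3 : ((D ∩ cell a (P * h)).ncard : ℝ) ≤ (D ∩ cell b (P * h)).ncard +
      (4 * T * (P * h) + 4 * T * T) := by exact_mod_cast h2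
  have h4 : (4 * T * (P * h) + 4 * T * T : ℝ) ≤
      4 * (4 * L ^ 2 * h) * (P * h) + 4 * (4 * L ^ 2 * h) * (4 * L ^ 2 * h) := by gcongr
  nlinarith

/-! ### Chains of nearly maximal total length -/

lemma sum_range_mul_eq (f : ℕ → ℝ) (N Q : ℕ) :
    ∑ n ∈ Finset.range (N * Q), f n =
      ∑ q ∈ Finset.range N, ∑ i ∈ Finset.range Q, f (q * Q + i) := by
  induction N with
  | zero => simp
  | succ N ih => rw [Finset.sum_range_succ, ← ih, Nat.succ_mul, Finset.sum_range_add]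

/-- In each row `g · j` the steps have length at most `R`, and the total displacement in the
direction `u` falls short of its maximum by at most `C`. By averaging there is a block of `Q`
consecutive positions in which all steps of all rows are close to `R • u`. -/
lemma exists_block_steps_near {E : Type*} [NormedAddCommGroup E] [InnerProductSpace ℝ E]
    (g : ℕ → ℕ → E) {N P Q : ℕ} (hN : 0 < N) {R C : ℝ} (hR : 0 ≤ R) {u : E} (hu : ‖u‖ ≤ 1)
    (hstep : ∀ n < N * Q, ∀ j < P, ‖g (n + 1) j - g n j‖ ≤ R)
    (hdef : ∀ j < P, N * Q * R - inner ℝ (g (N * Q) j - g 0 j) u ≤ C) :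
    ∃ q < N, ∀ j < P, ∀ i < Q,
      ‖g (q * Q + i + 1) j - g (q * Q + i) j - R • u‖ ^ 2 ≤ 2 * R * (P * C / N) := by
  set δ : ℕ → ℕ → ℝ := fun n j => R - inner ℝ (g (n + 1) j - g n j) u with hδ
  have hδ0 : ∀ n < N * Q, ∀ j < P, 0 ≤ δ n j := by
    intro n hn j hj
    have h1 := real_inner_le_norm (g (n + 1) j - g n j) u
    have h2 := hstep n hn j hj
    have h3 : ‖g (n + 1) j - g n j‖ * ‖u‖ ≤ R * 1 := by gcongr
    simp only [hδ]; linarith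
  have hrow : ∀ j < P, ∑ n ∈ Finset.range (N * Q), δ n j ≤ C := by
    intro j hj
    have : ∑ n ∈ Finset.range (N * Q), δ n j =
        N * Q * R - inner ℝ (g (N * Q) j - g 0 j) u := by
      have htel := Finset.sum_range_sub (fun n => g n j) (N * Q)
      simp only [hδ]
      rw [Finset.sum_sub_distrib, ← sum_inner, htel]
      simp
    rw [this]; exact hdef j hj
  have htot : ∑ q ∈ Finset.range N, ∑ j ∈ Finset.range P, ∑ i ∈ Finset.range Q, δ (q * Q + i) j ≤
      ∑ _q ∈ Finset.range N, (P * C / N : ℝ) := by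
    rw [Finset.sum_comm]
    refine (Finset.sum_le_sum (g := fun _ => C) fun j hj => ?_).trans ?_
    · rw [← sum_range_mul_eq (fun n => δ n j)]
      exact hrow j (Finset.mem_range.1 hj)
    have : (N : ℝ) ≠ 0 := by exact_mod_cast hN.ne'
    simp only [Finset.sum_const, Finset.card_range, nsmul_eq_mul]
    field_simp
    exact le_rfl
  obtain ⟨q, hq, hle⟩ := Finset.exists_le_of_sum_le ⟨0, Finset.mem_range.2 hN⟩ htot
  rw [Finset.mem_range] at hq
  refine ⟨q, hq, fun j hj i hi => ?_⟩
  have hlt : ∀ i < Q, q * Q + i < N * Q := fun i hi => by nlinarith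
  have h1 : δ (q * Q + i) j ≤ ∑ i ∈ Finset.range Q, δ (q * Q + i) j :=
    Finset.single_le_sum (f := fun i => δ (q * Q + i) j)
      (fun i hi => hδ0 _ (hlt i (Finset.mem_range.1 hi)) j hj) (Finset.mem_range.2 hi)
  have h2 : ∑ i ∈ Finset.range Q, δ (q * Q + i) j ≤
      ∑ j ∈ Finset.range P, ∑ i ∈ Finset.range Q, δ (q * Q + i) j :=
    Finset.single_le_sum (f := fun j => ∑ i ∈ Finset.range Q, δ (q * Q + i) j)
      (fun j hj => Finset.sum_nonneg fun i hi =>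
        hδ0 _ (hlt i (Finset.mem_range.1 hi)) j (Finset.mem_range.1 hj)) (Finset.mem_range.2 hj)
  have h3 : δ (q * Q + i) j ≤ P * C / N := h1.trans (h2.trans hle)
  have h4 := hstep _ (hlt i hi) j hj
  rw [norm_sub_sq_real, inner_smul_right, norm_smul, Real.norm_of_nonneg hR]
  have h5 : ‖g (q * Q + i + 1) j - g (q * Q + i) j‖ ^ 2 ≤ R ^ 2 := by gcongr
  have h6 : (R * ‖u‖) ^ 2 ≤ R ^ 2 := by
    have : R * ‖u‖ ≤ R := by nlinarith
    gcongr
  have h7 : R * δ (q * Q + i) j ≤ R * (P * C / N) := by gcongr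
  simp only [hδ] at h7
  nlinarith

/-! ### Expanded steps along a checkerboard strip -/

/-- If no step of the grid is expanded by a factor `1 + lam` more than the lower side of the strip,
then in some pair of consecutive squares of side `P * h` the values on the two squares nearly
differ by a translation: the rows of the grid are chains of nearly maximal total length, so
`exists_block_steps_near` applies. -/
theorem IsBiLipschitzSurjOn.exists_nearly_translated_squares {L lam : ℝ} {D : Set (ℤ × ℤ)}
    {F : ℤ × ℤ → ℤ × ℤ} (hF : IsBiLipschitzSurjOn L D F) (o : ℤ × ℤ) {h P N : ℕ}
    (hh : 0 < h) (hN : 0 < N) (hP0 : 0 < P)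
    (hlam : 0 < lam) (hlamN : lam + 1 / N ≤ 1 / (8 * (P : ℝ) ^ 4))
    (hgrid : ∀ n ≤ 2 * N * P, ∀ j < P, o + ((n : ℤ) * h, (j : ℤ) * h) ∈ D)
    (hcon : ∀ n < 2 * N * P, ∀ j < P,
      euclNorm (F (o + (((n : ℤ) + 1) * h, (j : ℤ) * h)) -
          F (o + ((n : ℤ) * h, (j : ℤ) * h))) / h <
        (1 + lam) * (euclNorm (F (o + (2 * (N : ℤ) * P * h, 0)) - F o) / (2 * N * P * h))) :
    ∃ q < N, ∃ v : EuclideanSpace ℝ (Fin 2), ∀ i < P, ∀ j < P,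
      ‖latticePoint (F (o + (((q * (2 * P) + P + i : ℕ) : ℤ) * h, (j : ℤ) * h))) -
        latticePoint (F (o + (((q * (2 * P) + i : ℕ) : ℤ) * h, (j : ℤ) * h))) - v‖ ≤ L * h := by
  have hL := hF.one_le
  have hhR : (0 : ℝ) < h := by exact_mod_cast hh
  have hPR : (0 : ℝ) < P := by exact_mod_cast hP0
  have hP1 : (1 : ℝ) ≤ P := by exact_mod_cast hP0
  have hNR : (0 : ℝ) < N := by exact_mod_cast hN
  set pt : ℕ → ℕ → ℤ × ℤ := fun n j => o + ((n : ℤ) * h, (j : ℤ) * h) with hpt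
  set g : ℕ → ℕ → EuclideanSpace ℝ (Fin 2) := fun n j => latticePoint (F (pt n j)) with hg
  have hnorm : ∀ n j n' j', ‖g n j - g n' j'‖ = euclNorm (F (pt n j) - F (pt n' j')) := by
    intro n j n' j'
    simp only [hg, euclNorm, latticePoint_sub]
  have hpt0 : pt 0 0 = o := by simp [hpt]
  have hptE : pt (N * (2 * P)) 0 = o + (2 * (N : ℤ) * P * h, 0) := by
    simp only [hpt]; push_cast; congr 2 <;> ring
  set W := g (N * (2 * P)) 0 - g 0 0 with hW
  have hWn : ‖W‖ = euclNorm (F (o + (2 * (N : ℤ) * P * h, 0)) - F o) := by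
    rw [hW, hnorm, hpt0, hptE]
  have hoD : o ∈ D := by rw [← hpt0]; exact hgrid 0 (Nat.zero_le _) 0 hP0
  have heD : o + (2 * (N : ℤ) * P * h, 0) ∈ D := by
    rw [← hptE]; exact hgrid _ (by nlinarith) 0 hP0
  have hlen : euclNorm (o + (2 * (N : ℤ) * P * h, 0) - o) = 2 * N * P * h := by
    rw [add_sub_cancel_left, euclNorm_horizontal, abs_of_nonneg (by positivity)]
    push_cast; ring
  have hWle : ‖W‖ ≤ L * (2 * N * P * h) := by
    rw [hWn, ← hlen]; exact hF.upper _ heD _ hoD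
  have hWpos : 0 < ‖W‖ := by
    have h1 := hF.lower _ heD _ hoD
    rw [hlen, ← hWn] at h1
    have h2 : 0 < L * ‖W‖ := lt_of_lt_of_le (by positivity) h1
    exact pos_of_mul_pos_right h2 (by linarith)
  have hlam1 : lam ≤ 1 := by
    have h1 : 1 / (8 * (P : ℝ) ^ 4) ≤ 1 := by
      rw [div_le_one (by positivity)]
      have : (1 : ℝ) ≤ (P : ℝ) ^ 4 := one_le_pow₀ hP1
      linarith
    have h2 : 0 < 1 / (N : ℝ) := by positivity
    linarith
  -- `R` bounds the length of a step, `u` is the direction of the lower side, and `C` bounds the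
  -- deficit of a row, whose ends are at distance at most `P * h` from those of the lower side
  set R := (1 + lam) * ‖W‖ / (2 * N * P) with hRdef
  have hR0 : 0 ≤ R := by positivity
  have hRle : R ≤ 2 * L * h := by
    rw [hRdef, div_le_iff₀ (by positivity)]
    have : (1 + lam) * ‖W‖ ≤ 2 * (L * (2 * N * P * h)) := by gcongr; linarith
    linarith
  set u := (‖W‖)⁻¹ • W with hu
  have hun : ‖u‖ = 1 := by
    rw [hu, norm_smul, norm_inv, norm_norm, inv_mul_cancel₀ hWpos.ne']
  have hWu : inner ℝ W u = ‖W‖ := by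
    rw [hu, inner_smul_right, real_inner_self_eq_norm_sq]
    field_simp
  set C := lam * ‖W‖ + 2 * (L * (P * h)) with hC
  have hstep : ∀ n < N * (2 * P), ∀ j < P, ‖g (n + 1) j - g n j‖ ≤ R := by
    intro n hn j hj
    have h1 := hcon n (by nlinarith) j hj
    rw [hnorm]
    rw [← hWn, div_lt_iff₀ hhR] at h1
    have h2 : (1 + lam) * (‖W‖ / (2 * N * P * h)) * h = R := by
      rw [hRdef]; field_simp
    rw [h2] at h1
    simpa [hpt] using h1.le
  have hvert : ∀ n ≤ 2 * N * P, ∀ j < P, ‖g n j - g n 0‖ ≤ L * (P * h) := by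
    intro n hn j hj
    rw [hnorm]
    refine (hF.upper _ (hgrid n hn j hj) _ (hgrid n hn 0 hP0)).trans ?_
    have : pt n j - pt n 0 = (0, (j : ℤ) * h) := by simp [hpt]
    change L * euclNorm (pt n j - pt n 0) ≤ _
    rw [this, euclNorm_vertical, abs_of_nonneg (by positivity)]
    push_cast
    have : (j : ℝ) ≤ P := by exact_mod_cast hj.le
    gcongr
  have hdef : ∀ j < P,
      N * (2 * P : ℕ) * R - inner ℝ (g (N * (2 * P)) j - g 0 j) u ≤ C := by
    intro j hj
    have e : g (N * (2 * P)) j - g 0 j =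
        W + ((g (N * (2 * P)) j - g (N * (2 * P)) 0) - (g 0 j - g 0 0)) := by
      rw [hW]; abel
    have h1 := hvert (N * (2 * P)) (by nlinarith) j hj
    have h2 := hvert 0 (Nat.zero_le _) j hj
    have h3 := norm_sub_le (g (N * (2 * P)) j - g (N * (2 * P)) 0) (g 0 j - g 0 0)
    have h4 := abs_real_inner_le_norm
      ((g (N * (2 * P)) j - g (N * (2 * P)) 0) - (g 0 j - g 0 0)) u
    rw [hun, mul_one] at h4
    have h5 := neg_le_of_abs_le h4
    have h6 : (N : ℝ) * (2 * P : ℕ) * R = (1 + lam) * ‖W‖ := by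
      rw [hRdef]; push_cast; field_simp
    rw [e, inner_add_left, hWu, h6, hC]
    linarith
  obtain ⟨q, hq, hsteps⟩ := exists_block_steps_near g hN hR0 hun.le hstep hdef
  -- an error `L * h / P` per step adds up to `L * h` over the `P` steps of a square
  have hbound : 2 * R * (P * C / N) ≤ (L * h / P) ^ 2 := by
    have h1 : P * C / N ≤ 2 * L * P ^ 2 * h * (lam + 1 / N) := by
      rw [div_le_iff₀ hNR, hC]
      have h2 : P * (lam * ‖W‖ + 2 * (L * (P * h))) ≤
          P * (lam * (L * (2 * N * P * h)) + 2 * (L * (P * h))) := by gcongr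
      refine h2.trans (le_of_eq ?_)
      field_simp
    have h2 : 2 * L * P ^ 2 * h * (lam + 1 / N) ≤ 2 * L * P ^ 2 * h * (1 / (8 * P ^ 4)) := by
      gcongr
    have h3 : 2 * L * P ^ 2 * h * (1 / (8 * P ^ 4)) = L * h / (4 * P ^ 2) := by
      field_simp; norm_num
    have h4 : 2 * R * (P * C / N) ≤ 2 * (2 * L * h) * (L * h / (4 * P ^ 2)) := by
      have : P * C / N ≤ L * h / (4 * P ^ 2) := by linarith
      gcongr
    refine h4.trans (le_of_eq ?_)
    field_simp; norm_num
  have hnear : ∀ j < P, ∀ i < 2 * P,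
      ‖g (q * (2 * P) + i + 1) j - g (q * (2 * P) + i) j - R • u‖ ≤ L * h / P := by
    intro j hj i hi
    have h1 := (hsteps j hj i hi).trans hbound
    exact (sq_le_sq₀ (norm_nonneg _) (by positivity)).1 h1
  have hsum : ∀ j < P, ∀ i < P,
      ‖g (q * (2 * P) + P + i) j - g (q * (2 * P) + i) j - (P : ℝ) • (R • u)‖ ≤ L * h := by
    intro j hj i hi
    have e : g (q * (2 * P) + P + i) j - g (q * (2 * P) + i) j - (P : ℝ) • (R • u) =
        ∑ t ∈ Finset.range P,
          (g (q * (2 * P) + (i + t) + 1) j - g (q * (2 * P) + (i + t)) j - R • u) := by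
      have htel := Finset.sum_range_sub (fun t => g (q * (2 * P) + (i + t)) j) P
      simp only [← add_assoc] at htel ⊢
      rw [Finset.sum_sub_distrib, htel]
      simp only [Finset.sum_const, Finset.card_range, add_zero]
      rw [Nat.cast_smul_eq_nsmul, add_right_comm]
    rw [e]
    refine (norm_sum_le _ _).trans ?_
    refine (Finset.sum_le_sum (g := fun _ => L * h / P) fun t ht => ?_).trans ?_
    · exact hnear j hj (i + t) (by have := Finset.mem_range.1 ht; omega)
    · simp only [Finset.sum_const, Finset.card_range, nsmul_eq_mul]
      refine le_of_eq ?_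
      field_simp
  exact ⟨q, hq, (P : ℝ) • (R • u), fun i hi j hj => hsum j hj i hi⟩

/-- The expansion lemma for an arbitrary base point `o`; `D` need only contain the points of the
grid of mesh `h`. If no step were expanded, the values on two
consecutive squares would nearly differ by a translation, and by
`IsBiLipschitzSurjOn.ncard_inter_cell_le`, applied in both directions, the two squares would have
nearly the same number of points. -/
theorem IsBiLipschitzSurjOn.exists_expanded_step {L d d' lam : ℝ} {D : Set (ℤ × ℤ)}
    {F : ℤ × ℤ → ℤ × ℤ} (hF : IsBiLipschitzSurjOn L D F) (o : ℤ × ℤ) {h P N : ℕ}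
    (hh : 0 < h) (hN : 0 < N) (hP0 : 0 < P) (hP : 32 * L ^ 2 < P * (d - d')) (hd : d - d' ≤ 1)
    (hlam : 0 < lam) (hlamN : lam + 1 / N ≤ 1 / (8 * (P : ℝ) ^ 4))
    (hgrid : ∀ n ≤ 2 * N * P, ∀ j < P, o + ((n : ℤ) * h, (j : ℤ) * h) ∈ D)
    (hcount : ∀ q < N,
      (d * ((P : ℝ) * h) ^ 2 ≤ (D ∩ cell (o + (2 * (q : ℤ) * (P * h), 0)) (P * h)).ncard ∧
        ((D ∩ cell (o + ((2 * (q : ℤ) + 1) * (P * h), 0)) (P * h)).ncard : ℝ) ≤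
          d' * ((P : ℝ) * h) ^ 2) ∨
      (((D ∩ cell (o + (2 * (q : ℤ) * (P * h), 0)) (P * h)).ncard : ℝ) ≤
          d' * ((P : ℝ) * h) ^ 2 ∧
        d * ((P : ℝ) * h) ^ 2 ≤
          (D ∩ cell (o + ((2 * (q : ℤ) + 1) * (P * h), 0)) (P * h)).ncard)) :
    ∃ n < 2 * N * P, ∃ j < P,
      (1 + lam) * (euclNorm (F (o + (2 * (N : ℤ) * P * h, 0)) - F o) / (2 * N * P * h)) ≤
        euclNorm (F (o + (((n : ℤ) + 1) * h, (j : ℤ) * h)) -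
          F (o + ((n : ℤ) * h, (j : ℤ) * h))) / h := by
  by_contra! hcon
  have hL := hF.one_le
  have hhR : (0 : ℝ) < h := by exact_mod_cast hh
  have hPR : (0 : ℝ) < P := by exact_mod_cast hP0
  obtain ⟨q, hq, v, hv⟩ :=
    hF.exists_nearly_translated_squares o hh hN hP0 hlam hlamN hgrid hcon
  set a : ℤ × ℤ := o + (2 * (q : ℤ) * (P * h), 0) with ha
  set b : ℤ × ℤ := o + ((2 * (q : ℤ) + 1) * (P * h), 0) with hb
  have hpa : ∀ i j : ℕ, a + ((i : ℤ) * h, (j : ℤ) * h) =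
      o + (((q * (2 * P) + i : ℕ) : ℤ) * h, (j : ℤ) * h) := by
    intro i j
    ext <;> simp only [ha, Prod.fst_add, Prod.snd_add] <;> push_cast <;> ring
  have hpb : ∀ i j : ℕ, b + ((i : ℤ) * h, (j : ℤ) * h) =
      o + (((q * (2 * P) + P + i : ℕ) : ℤ) * h, (j : ℤ) * h) := by
    intro i j
    ext <;> simp only [hb, Prod.fst_add, Prod.snd_add] <;> push_cast <;> ring
  have haD : ∀ i < P, ∀ j < P, a + ((i : ℤ) * h, (j : ℤ) * h) ∈ D := by
    intro i hi j hj
    rw [hpa]; exact hgrid _ (by nlinarith) j hj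
  have hbD : ∀ i < P, ∀ j < P, b + ((i : ℤ) * h, (j : ℤ) * h) ∈ D := by
    intro i hi j hj
    rw [hpb]; exact hgrid _ (by nlinarith) j hj
  have hab := hF.ncard_inter_cell_le a b h P hh v haD hbD (by
    intro i hi j hj
    rw [hpa, hpb]; exact hv i hi j hj)
  have hba := hF.ncard_inter_cell_le b a h P hh (-v) hbD haD (by
    intro i hi j hj
    rw [hpa, hpb]
    refine le_trans (le_of_eq ?_) (hv i hi j hj)
    rw [← norm_neg]
    congr 1
    abel)
  have herr : 4 * (4 * L ^ 2 * h) * (P * h) + 4 * (4 * L ^ 2 * h) ^ 2 <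
      (d - d') * ((P : ℝ) * h) ^ 2 := by
    have h1 : 4 * L ^ 2 ≤ P := by nlinarith
    have h2 : 4 * (4 * L ^ 2 * h) * (P * h) + 4 * (4 * L ^ 2 * h) ^ 2 =
        (16 * L ^ 2 * P + 16 * L ^ 2 * (4 * L ^ 2)) * h ^ 2 := by ring
    have h3 : (16 * L ^ 2 * P + 16 * L ^ 2 * (4 * L ^ 2)) * (h : ℝ) ^ 2 ≤
        (16 * L ^ 2 * P + 16 * L ^ 2 * P) * h ^ 2 := by gcongr
    have h4 : 32 * L ^ 2 * (P * (h : ℝ) ^ 2) < P * (d - d') * (P * h ^ 2) := by gcongr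
    nlinarith
  rcases hcount q hq with ⟨h1, h2⟩ | ⟨h1, h2⟩ <;> linarith

/-! ### Framed patches and their copies -/

/-- A square patch of side `2M` that contains all boundary points of its square. This is the part of
`IsInitialPatch` that the construction preserves; it makes the corners of all copies points
of the patch, whatever their parity. -/
structure IsFramed (M : ℕ) (Q : Set (ℤ × ℤ)) : Prop where
  subset_box : Q ⊆ box M
  boundary : ∀ p ∈ box M, |p.1| = M ∨ |p.2| = M → p ∈ Q

lemma IsInitialPatch.isFramed {M : ℕ} {Q : Set (ℤ × ℤ)} (h : IsInitialPatch M Q) :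
    IsFramed M Q := ⟨h.subset_box, h.boundary⟩

/-- The square of side `2M` with lower-left corner `w` meets `D` in a copy of `Q`. -/
def IsPlacedAt (D : Set (ℤ × ℤ)) (M : ℕ) (Q : Set (ℤ × ℤ)) (w : ℤ × ℤ) : Prop :=
  ∀ p, p ∈ Q ↔ p ∈ box M ∧ p + (w + ((M : ℤ), (M : ℤ))) ∈ D

lemma ContainsPatch.exists_isPlacedAt {D Q : Set (ℤ × ℤ)} {M : ℕ} (h : ContainsPatch D M Q) :
    ∃ w, IsPlacedAt D M Q w := by
  obtain ⟨v, rfl⟩ := h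
  refine ⟨v - ((M : ℤ), (M : ℤ)), fun p => ?_⟩
  simp

lemma mem_box {M : ℕ} {p : ℤ × ℤ} :
    p ∈ box M ↔ (-(M : ℤ) ≤ p.1 ∧ p.1 ≤ M) ∧ (-(M : ℤ) ≤ p.2 ∧ p.2 ≤ M) := by
  unfold box
  rw [Set.mem_prod, Set.mem_Icc, Set.mem_Icc]

lemma IsPlacedAt.corner_mem {D Q : Set (ℤ × ℤ)} {M : ℕ} {w : ℤ × ℤ} (h : IsPlacedAt D M Q w)
    (hQ : IsFramed M Q) : w ∈ D := by
  have hb : (-(M : ℤ), -(M : ℤ)) ∈ box M := by rw [mem_box]; simp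
  have := ((h _).1 (hQ.boundary _ hb (by simp))).2
  convert this using 1
  ext <;> simp

lemma IsPlacedAt.right_corner_mem {D Q : Set (ℤ × ℤ)} {M : ℕ} {w : ℤ × ℤ}
    (h : IsPlacedAt D M Q w) (hQ : IsFramed M Q) : w + (2 * (M : ℤ), 0) ∈ D := by
  have hb : ((M : ℤ), -(M : ℤ)) ∈ box M := by rw [mem_box]; simp
  have := ((h _).1 (hQ.boundary _ hb (by simp))).2
  convert this using 1
  ext
  · simp only [Prod.fst_add]; ring
  · simp

lemma IsPlacedAt.ncard_inter_cell {D Q : Set (ℤ × ℤ)} {M : ℕ} {w : ℤ × ℤ} (hM : 0 < M)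
    (h : IsPlacedAt D M Q w) :
    ((D ∩ cell w (2 * M)).ncard : ℝ) = patchDensity M Q * (2 * (M : ℝ)) ^ 2 := by
  have hMR : (0 : ℝ) < M := by exact_mod_cast hM
  rw [patchDensity, div_mul_cancel₀ _ (by positivity)]
  have : D ∩ cell w (2 * M) = (fun p => p + (w + ((M : ℤ), (M : ℤ)))) ''
      (Q ∩ Set.Ico (-(M : ℤ)) M ×ˢ Set.Ico (-(M : ℤ)) M) := by
    ext p
    simp only [Set.mem_image, Set.mem_inter_iff, mem_cell, Set.mem_prod, Set.mem_Ico]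
    push_cast
    constructor
    · rintro ⟨hp, hc⟩
      refine ⟨p - (w + ((M : ℤ), (M : ℤ))), ⟨(h _).2 ⟨?_, by simpa using hp⟩, ?_⟩, by simp⟩
      · rw [mem_box]; simp only [Prod.fst_sub, Prod.snd_sub, Prod.fst_add, Prod.snd_add]; omega
      · simp only [Prod.fst_sub, Prod.snd_sub, Prod.fst_add, Prod.snd_add]; omega
    · rintro ⟨p, ⟨hp, hc⟩, rfl⟩
      refine ⟨((h _).1 hp).2, ?_⟩
      simp only [Prod.fst_add, Prod.snd_add]; omega
  rw [this, Set.ncard_image_of_injective _ (add_left_injective _)]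

open Classical in
/-- The patch, `A` or `B`, of which the copy in column `a` and row `b` of `blockPatch M K N A B`
is a translate. -/
noncomputable def copyAt (K N : ℕ) (A B : Set (ℤ × ℤ)) (a b : ℕ) : Set (ℤ × ℤ) :=
  if b < K ∧ Odd (a / K + N) then B else A

lemma IsFramed.copyAt {M K N : ℕ} {A B : Set (ℤ × ℤ)} (hA : IsFramed M A) (hB : IsFramed M B)
    (a b : ℕ) : IsFramed M (copyAt K N A B a b) := by
  unfold _root_.copyAt
  split_ifs <;> assumption

lemma mem_blockPatch {M K N : ℕ} {A B : Set (ℤ × ℤ)} {p : ℤ × ℤ} :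
    p ∈ blockPatch M K N A B ↔ ∃ a b : ℕ, a < K * (2 * N + 1) ∧ b < K * (2 * N + 1) ∧
      p - ((2 * (a : ℤ) + 1 - K * (2 * N + 1)) * M, (2 * (b : ℤ) + 1 - K * (2 * N + 1)) * M) ∈
        copyAt K N A B a b := by
  simp only [blockPatch, Set.mem_ofPred_eq, copyAt]
  refine exists_congr fun a => exists_congr fun b => and_congr_right fun _ => and_congr_right
    fun _ => ?_
  split_ifs <;> tauto

/-- A coordinate in a row of `n` intervals of length `2M`, centered at the origin, lies in one of
them, and is an endpoint of it if it is an endpoint of the row. -/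
lemma exists_copy_index {M n : ℕ} (hM : 0 < M) (hn : 0 < n) {t : ℤ}
    (h0 : -((n * M : ℕ) : ℤ) ≤ t) (h1 : t ≤ ((n * M : ℕ) : ℤ)) :
    ∃ a < n, (-(M : ℤ) ≤ t - (2 * (a : ℤ) + 1 - n) * M ∧ t - (2 * (a : ℤ) + 1 - n) * M ≤ M) ∧
      (|t| = ((n * M : ℕ) : ℤ) → |t - (2 * (a : ℤ) + 1 - n) * M| = M) := by
  push_cast at h0 h1 ⊢
  have hM' : (0 : ℤ) < M := by exact_mod_cast hM
  have key : ∃ a < n, (-(M : ℤ) ≤ t - (2 * (a : ℤ) + 1 - n) * M ∧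
      t - (2 * (a : ℤ) + 1 - n) * M ≤ M) := by
    rcases h1.lt_or_eq with h1 | rfl
    · have e1 := Int.emod_nonneg (t + n * M) (show (2 * M : ℤ) ≠ 0 by positivity)
      have e2 := Int.emod_lt_of_pos (t + n * M) (show 0 < (2 * M : ℤ) by positivity)
      have e3 := Int.mul_ediv_add_emod (t + n * M) (2 * M)
      have e4 : 0 ≤ (t + n * M) / (2 * M) := Int.ediv_nonneg (by linarith) (by positivity)
      have e5 : (t + n * M) / (2 * M) < n :=
        Int.ediv_lt_of_lt_mul (by positivity) (by nlinarith)
      refine ⟨((t + n * M) / (2 * M)).toNat, by omega, ?_⟩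
      rw [Int.toNat_of_nonneg e4]
      constructor <;> nlinarith
    · refine ⟨n - 1, by omega, ?_⟩
      rw [Nat.cast_sub hn]
      push_cast
      constructor <;> nlinarith
  obtain ⟨a, ha, ha1, ha2⟩ := key
  refine ⟨a, ha, ⟨ha1, ha2⟩, fun ht => ?_⟩
  have ha' : (a : ℤ) + 1 ≤ n := by exact_mod_cast ha
  have ha0 : (0 : ℤ) ≤ a := by positivity
  have m1 : (a : ℤ) * M + M ≤ n * M := by nlinarith
  have m2 : (0 : ℤ) ≤ a * M := by positivity
  rcases abs_eq (by positivity) |>.1 ht with h | h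
  · rw [abs_eq hM'.le]; left; nlinarith
  · rw [abs_eq hM'.le]; right; nlinarith

lemma IsFramed.blockPatch {M K N : ℕ} {A B : Set (ℤ × ℤ)} (hM : 0 < M) (hK : 0 < K)
    (hA : IsFramed M A) (hB : IsFramed M B) :
    IsFramed (K * (2 * N + 1) * M) (blockPatch M K N A B) := by
  have hM' : (0 : ℤ) < M := by exact_mod_cast hM
  constructor
  · intro p hp
    obtain ⟨a, b, ha, hb, hp⟩ := mem_blockPatch.1 hp
    have hbox := (hA.copyAt hB a b).subset_box hp
    rw [mem_box] at hbox ⊢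
    simp only [Prod.fst_sub, Prod.snd_sub] at hbox
    have ha' : (a : ℤ) + 1 ≤ K * (2 * N + 1) := by exact_mod_cast ha
    have hb' : (b : ℤ) + 1 ≤ K * (2 * N + 1) := by exact_mod_cast hb
    push_cast
    have m1 := mul_le_mul_of_nonneg_right ha' hM'.le
    have m2 := mul_le_mul_of_nonneg_right hb' hM'.le
    have m3 : (0 : ℤ) ≤ a * M := by positivity
    have m4 : (0 : ℤ) ≤ b * M := by positivity
    refine ⟨⟨?_, ?_⟩, ?_, ?_⟩ <;> nlinarith
  · intro p hp hbd
    rw [mem_box] at hp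
    have hn : 0 < K * (2 * N + 1) := by positivity
    obtain ⟨a, ha, ha1, ha2⟩ := exists_copy_index hM hn hp.1.1 hp.1.2
    obtain ⟨b, hb, hb1, hb2⟩ := exists_copy_index hM hn hp.2.1 hp.2.2
    push_cast at ha1 ha2 hb1 hb2 hbd
    refine mem_blockPatch.2 ⟨a, b, ha, hb, (hA.copyAt hB a b).boundary _ ?_ ?_⟩
    · rw [mem_box]; exact ⟨ha1, hb1⟩
    · exact hbd.imp ha2 hb2

/-- The copies that make up a copy of `blockPatch M K N A B` in `D` are themselves copies in `D`:
since patches are framed, neighbouring copies contribute no other points to the square of a copy. -/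
lemma IsPlacedAt.copyAt {D A B : Set (ℤ × ℤ)} {M K N : ℕ} {w : ℤ × ℤ} (hM : 0 < M)
    (hA : IsFramed M A) (hB : IsFramed M B)
    (h : IsPlacedAt D (K * (2 * N + 1) * M) (blockPatch M K N A B) w) {a b : ℕ}
    (ha : a < K * (2 * N + 1)) (hb : b < K * (2 * N + 1)) :
    IsPlacedAt D M (copyAt K N A B a b) (w + (2 * (a : ℤ) * M, 2 * (b : ℤ) * M)) := by
  have hM' : (0 : ℤ) < M := by exact_mod_cast hM
  have ha' : (a : ℤ) + 1 ≤ K * (2 * N + 1) := by exact_mod_cast ha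
  have hb' : (b : ℤ) + 1 ≤ K * (2 * N + 1) := by exact_mod_cast hb
  have m1 := mul_le_mul_of_nonneg_right ha' hM'.le
  have m2 := mul_le_mul_of_nonneg_right hb' hM'.le
  have m3 : (0 : ℤ) ≤ a * M := by positivity
  have m4 : (0 : ℤ) ≤ b * M := by positivity
  intro p
  have key : p ∈ box M → (p ∈ _root_.copyAt K N A B a b ↔
      p + ((2 * (a : ℤ) + 1 - K * (2 * N + 1)) * M, (2 * (b : ℤ) + 1 - K * (2 * N + 1)) * M) ∈
        blockPatch M K N A B) := by
    intro hp
    refine ⟨fun hpQ => mem_blockPatch.2 ⟨a, b, ha, hb, by rwa [add_sub_cancel_right]⟩,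
      fun hpQ => ?_⟩
    obtain ⟨a', b', -, -, hp'⟩ := mem_blockPatch.1 hpQ
    by_cases hab : a = a' ∧ b = b'
    · obtain ⟨rfl, rfl⟩ := hab
      rwa [add_sub_cancel_right] at hp'
    · have hbox := (hA.copyAt hB a' b').subset_box hp'
      have hp0 := hp
      rw [mem_box] at hbox hp
      simp only [Prod.fst_sub, Prod.snd_sub, Prod.fst_add, Prod.snd_add] at hbox
      have side : ∀ (c c' : ℕ) (t : ℤ), c ≠ c' → -(M : ℤ) ≤ t → t ≤ M →
          -(M : ℤ) ≤ t + (2 * c - 2 * c') * M → t + (2 * c - 2 * c') * M ≤ M → |t| = M := by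
        intro c c' t hc h1 h2 h3 h4
        rw [abs_eq hM'.le]
        rcases lt_or_gt_of_ne hc with hc | hc
        · left
          have : (c : ℤ) + 1 ≤ c' := by exact_mod_cast hc
          nlinarith
        · right
          have : (c' : ℤ) + 1 ≤ c := by exact_mod_cast hc
          nlinarith
      refine (hA.copyAt hB a b).boundary _ hp0 ?_
      rw [not_and_or] at hab
      refine hab.imp (fun hne => ?_) (fun hne => ?_)
      · exact side a a' _ hne hp.1.1 hp.1.2 (by linarith [hbox.1.1]) (by linarith [hbox.1.2])
      · exact side b b' _ hne hp.2.1 hp.2.2 (by linarith [hbox.2.1]) (by linarith [hbox.2.2])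
  have hshift : p + (w + (2 * (a : ℤ) * M, 2 * (b : ℤ) * M) + ((M : ℤ), (M : ℤ))) =
      p + ((2 * (a : ℤ) + 1 - K * (2 * N + 1)) * M, (2 * (b : ℤ) + 1 - K * (2 * N + 1)) * M) +
        (w + (((K * (2 * N + 1) * M : ℕ) : ℤ), ((K * (2 * N + 1) * M : ℕ) : ℤ))) := by
    ext <;> simp only [Prod.fst_add, Prod.snd_add] <;> push_cast <;> ring
  rw [hshift]
  constructor
  · intro hp
    have hbox := (hA.copyAt hB a b).subset_box hp
    exact ⟨hbox, ((h _).1 ((key hbox).1 hp)).2⟩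
  · rintro ⟨hbox, hpD⟩
    refine (key hbox).2 ((h _).2 ⟨?_, hpD⟩)
    rw [mem_box] at hbox ⊢
    simp only [Prod.fst_add, Prod.snd_add]
    push_cast
    refine ⟨⟨?_, ?_⟩, ?_, ?_⟩ <;> nlinarith

/-- A square cut into `K * K` squares of side `m`, each with `c` points, has `K * K * c` points. -/
lemma ncard_inter_cell_mul {D : Set (ℤ × ℤ)} {o : ℤ × ℤ} {K m c : ℕ} (hm : 0 < m)
    (h : ∀ i < K, ∀ j < K, (D ∩ cell (o + ((i : ℤ) * m, (j : ℤ) * m)) m).ncard = c) :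
    (D ∩ cell o (K * m)).ncard = K * K * c := by
  have hm' : (0 : ℤ) < m := by exact_mod_cast hm
  have hfin : ∀ o M, (D ∩ cell o M).Finite := fun o M =>
    (finite_cell _ _).subset Set.inter_subset_right
  rw [Set.ncard_eq_toFinset_card _ (hfin o (K * m)),
    Finset.card_eq_sum_card_fiberwise (t := Finset.range K ×ˢ Finset.range K)
      (f := fun p : ℤ × ℤ => (((p.1 - o.1) / m).toNat, ((p.2 - o.2) / m).toNat))]
  · have : ∀ ij ∈ Finset.range K ×ˢ Finset.range K,
        (Finset.filter (fun p : ℤ × ℤ =>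
          (((p.1 - o.1) / m).toNat, ((p.2 - o.2) / m).toNat) = ij)
          (hfin o (K * m)).toFinset).card = c := by
      rintro ⟨i, j⟩ hij
      rw [Finset.mem_product, Finset.mem_range, Finset.mem_range] at hij
      obtain ⟨hi, hj⟩ := hij
      dsimp only at hi hj
      rw [← h i hi j hj, Set.ncard_eq_toFinset_card _ (hfin _ _)]
      congr 1
      ext p
      have div_iff : ∀ (t : ℤ) (i : ℕ), i < K → ((0 ≤ t ∧ t < K * m) ∧ (t / m).toNat = i ↔
          (i : ℤ) * m ≤ t ∧ t < (i : ℤ) * m + m) := by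
        intro t i hi
        have hi' : (i : ℤ) + 1 ≤ K := by exact_mod_cast hi
        have hi0 : (0 : ℤ) ≤ i * m := by positivity
        constructor
        · rintro ⟨⟨h0, -⟩, rfl⟩
          rw [Int.toNat_of_nonneg (Int.ediv_nonneg h0 hm'.le)]
          have e1 := Int.emod_nonneg t hm'.ne'
          have e2 := Int.emod_lt_of_pos t hm'
          have e3 := Int.mul_ediv_add_emod t m
          constructor <;> nlinarith
        · rintro ⟨h1, h2⟩
          have : t / m = i := by
            rw [Int.ediv_eq_iff_of_pos hm']
            constructor <;> linarith
          refine ⟨⟨by linarith, by nlinarith⟩, by omega⟩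
      have d1 := div_iff (p.1 - o.1) i hi
      have d2 := div_iff (p.2 - o.2) j hj
      simp only [Finset.mem_filter, Set.Finite.mem_toFinset, Set.mem_inter_iff, mem_cell,
        Prod.mk.injEq, Prod.fst_add, Prod.snd_add]
      push_cast
      constructor
      · rintro ⟨⟨hD, h1, h2⟩, e1, e2⟩
        have := d1.1 ⟨⟨by omega, by omega⟩, e1⟩
        have := d2.1 ⟨⟨by omega, by omega⟩, e2⟩
        exact ⟨hD, by omega, by omega⟩
      · rintro ⟨hD, h1, h2⟩
        have := d1.2 ⟨by omega, by omega⟩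
        have := d2.2 ⟨by omega, by omega⟩
        exact ⟨⟨hD, by omega, by omega⟩, by omega, by omega⟩
    rw [Finset.sum_congr rfl this]
    simp
  · intro p hp
    simp only [Finset.mem_coe, Set.Finite.mem_toFinset, Set.mem_inter_iff, mem_cell] at hp
    push_cast at hp
    have e1 : (p.1 - o.1) / m < K := Int.ediv_lt_of_lt_mul hm' (by omega)
    have e2 : (p.2 - o.2) / m < K := Int.ediv_lt_of_lt_mul hm' (by omega)
    have e3 : 0 ≤ (p.1 - o.1) / m := Int.ediv_nonneg (by omega) hm'.le
    have e4 : 0 ≤ (p.2 - o.2) / m := Int.ediv_nonneg (by omega) hm'.le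
    simp only [Finset.coe_product, Finset.coe_range, Set.mem_prod, Set.mem_Iio]
    omega

open Classical in
/-- The blocks in the lowest row of `blockPatch M K N A B` have the density of `A` or of `B`,
alternately. -/
lemma IsPlacedAt.ncard_inter_block {D A B : Set (ℤ × ℤ)} {M K N : ℕ} {w : ℤ × ℤ} (hM : 0 < M)
    (hK : 0 < K) (hA : IsFramed M A) (hB : IsFramed M B)
    (h : IsPlacedAt D (K * (2 * N + 1) * M) (blockPatch M K N A B) w) {k : ℕ}
    (hk : k < 2 * N + 1) :
    ((D ∩ cell (w + ((k : ℤ) * (2 * K * M), 0)) (K * (2 * M))).ncard : ℝ) =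
      patchDensity M (if Odd (k + N) then B else A) * (2 * (K : ℝ) * M) ^ 2 := by
  have key : ∀ i < K, ∀ j < K, ((D ∩ cell (w + ((k : ℤ) * (2 * K * M), 0) +
      ((i : ℤ) * (2 * M : ℕ), (j : ℤ) * (2 * M : ℕ))) (2 * M)).ncard : ℝ) =
        patchDensity M (if Odd (k + N) then B else A) * (2 * (M : ℝ)) ^ 2 := by
    intro i hi j hj
    have ha : k * K + i < K * (2 * N + 1) := by nlinarith
    have hb : j < K * (2 * N + 1) := by nlinarith
    have hp := (h.copyAt hM hA hB ha hb).ncard_inter_cell hM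
    have hdiv : (k * K + i) / K = k := by
      rw [Nat.div_eq_iff hK]
      constructor
      · linarith
      · omega
    rw [_root_.copyAt, hdiv] at hp
    simp only [hj, true_and] at hp
    rw [← hp]
    congr 4
    ext <;> simp only [Prod.fst_add, Prod.snd_add] <;> push_cast <;> ring
  have hall : ∀ i < K, ∀ j < K, (D ∩ cell (w + ((k : ℤ) * (2 * K * M), 0) +
      ((i : ℤ) * (2 * M : ℕ), (j : ℤ) * (2 * M : ℕ))) (2 * M)).ncard =
      (D ∩ cell (w + ((k : ℤ) * (2 * K * M), 0) +
      (((0 : ℕ) : ℤ) * (2 * M : ℕ), ((0 : ℕ) : ℤ) * (2 * M : ℕ))) (2 * M)).ncard := by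
    intro i hi j hj
    have := (key i hi j hj).trans (key 0 hK 0 hK).symm
    exact_mod_cast this
  rw [ncard_inter_cell_mul (by positivity) hall]
  push_cast
  have := key 0 hK 0 hK
  push_cast at this
  rw [this]
  ring

/-! ### Passing from a patch to the patches it is made of -/

lemma euclNorm_sub_le (p q r : ℤ × ℤ) :
    euclNorm (p - r) ≤ euclNorm (p - q) + euclNorm (q - r) := by
  simp only [euclNorm, latticePoint_sub]
  exact norm_sub_le_norm_sub_add_norm_sub _ _ _

lemma euclNorm_sub_le_sum (G : ℕ → ℤ × ℤ) (m : ℕ) :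
    euclNorm (G m - G 0) ≤ ∑ t ∈ Finset.range m, euclNorm (G (t + 1) - G t) := by
  induction m with
  | zero => simp [euclNorm_eq_sqrt]
  | succ m ih =>
    rw [Finset.sum_range_succ]
    linarith [euclNorm_sub_le (G (m + 1)) (G m) (G 0)]

/-- The conditions on the constants under which a step expanded by a factor `1 + 2 * lam` can be
found: `32 * L ^ 2 < P * (d - d')` makes the mesh of the grid fine enough to tell the densities `d`
and `d'` apart, `lam` and `1 / N` are small with respect to the mesh, and the last condition lets
the factor `1 + 2 * lam` absorb the last of the `2N + 1` blocks, which does not belong to the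
strip of `2N` blocks, and still leave a factor `1 + lam`. -/
structure AdmissibleConstants (L d d' lam : ℝ) (N P : ℕ) : Prop where
  lam_pos : 0 < lam
  N_pos : 0 < N
  P_pos : 0 < P
  gap_le : d - d' ≤ 1
  mesh : 32 * L ^ 2 < P * (d - d')
  small : 2 * lam + 1 / N ≤ 1 / (8 * (P : ℝ) ^ 4)
  absorb : (1 + 2 * lam) * L ^ 2 ≤ 2 * lam * N

/-- The inductive step of the construction: if the lower side of a copy of
`blockPatch M (m * P) N A B` in `D` is expanded by `E`, then `D` contains a copy of `A` or `B` whose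
lower side is expanded by `(1 + lam) * E`. The step of the grid given by
`IsBiLipschitzSurjOn.exists_expanded_step` is a chain of `m` lower sides of copies, one of
which is expanded at least as much. -/
theorem IsBiLipschitzSurjOn.exists_expanded_copy {L d d' lam : ℝ} {D : Set (ℤ × ℤ)}
    {F : ℤ × ℤ → ℤ × ℤ} (hF : IsBiLipschitzSurjOn L D F) {N P : ℕ}
    (hc : AdmissibleConstants L d d' lam N P) {M m : ℕ} (hM : 0 < M) (hm : 0 < m)
    {A B : Set (ℤ × ℤ)} (hA : IsFramed M A) (hB : IsFramed M B)
    (hdens : (patchDensity M A ≤ d' ∧ d ≤ patchDensity M B) ∨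
      (patchDensity M B ≤ d' ∧ d ≤ patchDensity M A)) {w : ℤ × ℤ}
    (hw : IsPlacedAt D (m * P * (2 * N + 1) * M) (blockPatch M (m * P) N A B) w) {E : ℝ}
    (hE : 1 / L ≤ E)
    (hside : E * (2 * (m * P * (2 * N + 1) * M : ℕ)) ≤
      euclNorm (F (w + (2 * ((m * P * (2 * N + 1) * M : ℕ) : ℤ), 0)) - F w)) :
    ∃ w', (IsPlacedAt D M A w' ∨ IsPlacedAt D M B w') ∧
      (1 + lam) * E * (2 * M) ≤ euclNorm (F (w' + (2 * (M : ℤ), 0)) - F w') := by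
  obtain ⟨hlam, hN, hP0, hgap, hP, hsmall, habs⟩ := hc
  have hL := hF.one_le
  have hK : 0 < m * P := by positivity
  have hMR : (0 : ℝ) < M := by exact_mod_cast hM
  have hmR : (0 : ℝ) < m := by exact_mod_cast hm
  have hPR : (0 : ℝ) < P := by exact_mod_cast hP0
  have hNR : (0 : ℝ) < N := by exact_mod_cast hN
  have hcopy : ∀ a < m * P * (2 * N + 1), ∀ b < m * P * (2 * N + 1),
      IsPlacedAt D M (_root_.copyAt (m * P) N A B a b)
        (w + (2 * (a : ℤ) * M, 2 * (b : ℤ) * M)) := fun a ha b hb => hw.copyAt hM hA hB ha hb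
  have hcorner : ∀ a < m * P * (2 * N + 1), ∀ b < m * P * (2 * N + 1),
      w + (2 * (a : ℤ) * M, 2 * (b : ℤ) * M) ∈ D :=
    fun a ha b hb => (hcopy a ha b hb).corner_mem (hA.copyAt hB a b)
  have hgrid : ∀ n ≤ 2 * N * P, ∀ j < P,
      w + ((n : ℤ) * (2 * m * M : ℕ), (j : ℤ) * (2 * m * M : ℕ)) ∈ D := by
    intro n hn j hj
    have := hcorner (n * m) (by nlinarith) (j * m) (by nlinarith)
    convert this using 1
    ext <;> simp only [Prod.fst_add, Prod.snd_add] <;> push_cast <;> ring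
  have hblock : ∀ k < 2 * N + 1, ((D ∩ cell (w + ((k : ℤ) * (P * (2 * m * M : ℕ)), 0))
      (P * (2 * m * M))).ncard : ℝ) =
      patchDensity M (if Odd (k + N) then B else A) * ((P : ℝ) * (2 * m * M : ℕ)) ^ 2 := by
    intro k hk
    have e1 : ((k : ℤ) * (P * (2 * m * M : ℕ)), (0 : ℤ)) =
        ((k : ℤ) * (2 * (m * P : ℕ) * M), 0) := by
      push_cast; congr 1; ring
    have e2 : P * (2 * m * M) = m * P * (2 * M) := by ring
    rw [e1, e2, hw.ncard_inter_block hM hK hA hB hk]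
    push_cast
    ring
  have hcount : ∀ q < N,
      (d * ((P : ℝ) * (2 * m * M : ℕ)) ^ 2 ≤
          (D ∩ cell (w + (2 * (q : ℤ) * (P * (2 * m * M : ℕ)), 0)) (P * (2 * m * M))).ncard ∧
        ((D ∩ cell (w + ((2 * (q : ℤ) + 1) * (P * (2 * m * M : ℕ)), 0))
          (P * (2 * m * M))).ncard : ℝ) ≤ d' * ((P : ℝ) * (2 * m * M : ℕ)) ^ 2) ∨
      (((D ∩ cell (w + (2 * (q : ℤ) * (P * (2 * m * M : ℕ)), 0)) (P * (2 * m * M))).ncard : ℝ) ≤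
          d' * ((P : ℝ) * (2 * m * M : ℕ)) ^ 2 ∧
        d * ((P : ℝ) * (2 * m * M : ℕ)) ^ 2 ≤
          (D ∩ cell (w + ((2 * (q : ℤ) + 1) * (P * (2 * m * M : ℕ)), 0))
            (P * (2 * m * M))).ncard) := by
    intro q hq
    have h1 := hblock (2 * q) (by omega)
    have h2 := hblock (2 * q + 1) (by omega)
    rw [Nat.cast_mul, Nat.cast_two] at h1
    rw [Nat.cast_add, Nat.cast_mul, Nat.cast_two, Nat.cast_one] at h2
    rw [h1, h2]
    have hpos : (0 : ℝ) ≤ ((P : ℝ) * (2 * m * M : ℕ)) ^ 2 := by positivity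
    by_cases hodd : Odd (2 * q + N)
    · have hodd' : ¬ Odd (2 * q + 1 + N) := by
        rw [Nat.not_odd_iff_even]; obtain ⟨r, hr⟩ := hodd; exact ⟨r + 1, by omega⟩
      rw [if_pos hodd, if_neg hodd']
      rcases hdens with ⟨ha, hb⟩ | ⟨ha, hb⟩
      · left; constructor <;> gcongr
      · right; constructor <;> gcongr
    · have hodd' : Odd (2 * q + 1 + N) := by
        rw [Nat.not_odd_iff_even] at hodd; obtain ⟨r, hr⟩ := hodd; exact ⟨r, by omega⟩
      rw [if_neg hodd, if_pos hodd']
      rcases hdens with ⟨ha, hb⟩ | ⟨ha, hb⟩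
      · right; constructor <;> gcongr
      · left; constructor <;> gcongr
  obtain ⟨n, hn, j, hj, hnj⟩ := hF.exists_expanded_step w (h := 2 * m * M) (by positivity) hN hP0
    hP hgap (by positivity) hsmall hgrid hcount
  set X := euclNorm (F (w + (2 * (N : ℤ) * P * (2 * m * M : ℕ), 0)) - F w) with hX
  have hh : (((2 * m * M : ℕ)) : ℝ) = 2 * m * M := by push_cast; ring
  rw [hh] at hnj
  -- the whole lower side has one block more than the strip
  have hXge : E * (2 * (m * P * (2 * N + 1) * M)) ≤ X + L * (P * (2 * m * M)) := by
    have h1 := euclNorm_sub_le (F (w + (2 * ((m * P * (2 * N + 1) * M : ℕ) : ℤ), 0)))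
      (F (w + (2 * (N : ℤ) * P * (2 * m * M : ℕ), 0))) (F w)
    have hR : w + (2 * ((m * P * (2 * N + 1) * M : ℕ) : ℤ), 0) ∈ D :=
      hw.right_corner_mem (hA.blockPatch hM hK hB)
    have hS : w + (2 * (N : ℤ) * P * (2 * m * M : ℕ), 0) ∈ D := by
      have := hgrid (2 * N * P) le_rfl 0 hP0
      convert this using 1
      ext <;> simp only [Prod.fst_add, Prod.snd_add] <;> push_cast <;> ring
    have h2 := hF.upper _ hR _ hS
    have h3 : w + (2 * ((m * P * (2 * N + 1) * M : ℕ) : ℤ), 0) -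
        (w + (2 * (N : ℤ) * P * (2 * m * M : ℕ), 0)) = ((P : ℤ) * (2 * m * M), 0) := by
      ext <;> simp only [Prod.fst_add, Prod.snd_add, Prod.fst_sub, Prod.snd_sub] <;> push_cast <;>
        ring
    rw [h3, euclNorm_horizontal, abs_of_nonneg (by positivity)] at h2
    push_cast at h1 h2 hside hX ⊢
    rw [hX]
    linarith
  have hgain : (1 + lam) * E ≤ (1 + 2 * lam) * (X / (2 * N * P * (2 * m * M))) := by
    have hLE : 1 ≤ L * E := by
      rw [div_le_iff₀ (by linarith)] at hE; linarith
    have h1 : E - L / (2 * N) ≤ X / (2 * N * P * (2 * m * M)) := by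
      rw [le_div_iff₀ (by positivity)]
      have h2 : (E - L / (2 * N)) * (2 * N * P * (2 * m * M)) =
          E * (2 * (m * P * (2 * N + 1) * M)) - L * (P * (2 * m * M)) -
            E * (2 * m * P * M) := by
        field_simp; ring
      have h3 : 0 ≤ E * (2 * m * P * M) := by
        have : 0 ≤ E := le_trans (by positivity) hE
        positivity
      linarith
    have h2 : (1 + 2 * lam) * (E - L / (2 * N)) ≤
        (1 + 2 * lam) * (X / (2 * N * P * (2 * m * M))) := by gcongr
    have h3 : (1 + 2 * lam) * (L / (2 * N)) ≤ lam * E := by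
      rw [← mul_div_assoc, div_le_iff₀ (by positivity)]
      have h4 : (1 + 2 * lam) * L * 1 ≤ (1 + 2 * lam) * L * (L * E) := by gcongr
      have h5 : (1 + 2 * lam) * L ^ 2 * E ≤ 2 * lam * N * E := by
        have : 0 ≤ E := le_trans (by positivity) hE
        gcongr
      nlinarith
    nlinarith
  have hlong : (1 + lam) * E * (2 * m * M) ≤
      euclNorm (F (w + (((n : ℤ) + 1) * (2 * m * M : ℕ), (j : ℤ) * (2 * m * M : ℕ))) -
        F (w + ((n : ℤ) * (2 * m * M : ℕ), (j : ℤ) * (2 * m * M : ℕ)))) := by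
    rw [← le_div_iff₀ (by positivity)]
    exact hgain.trans hnj
  set G : ℕ → ℤ × ℤ := fun t =>
    F (w + (2 * ((n * m + t : ℕ) : ℤ) * M, 2 * ((j * m : ℕ) : ℤ) * M)) with hG
  have hG0 : G 0 = F (w + ((n : ℤ) * (2 * m * M : ℕ), (j : ℤ) * (2 * m * M : ℕ))) := by
    simp only [hG]; push_cast; congr 3 <;> ring
  have hGm : G m = F (w + (((n : ℤ) + 1) * (2 * m * M : ℕ), (j : ℤ) * (2 * m * M : ℕ))) := by
    simp only [hG]; push_cast; congr 3 <;> ring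
  rw [← hG0, ← hGm] at hlong
  have hsum : ∑ _t ∈ Finset.range m, (1 + lam) * E * (2 * M) ≤
      ∑ t ∈ Finset.range m, euclNorm (G (t + 1) - G t) := by
    refine le_trans (le_of_eq ?_) (hlong.trans (euclNorm_sub_le_sum G m))
    simp only [Finset.sum_const, Finset.card_range, nsmul_eq_mul]
    ring
  obtain ⟨t, ht, hle⟩ := Finset.exists_le_of_sum_le ⟨0, Finset.mem_range.2 hm⟩ hsum
  rw [Finset.mem_range] at ht
  have ha : n * m + t < m * P * (2 * N + 1) := by
    have : (n + 1) * m ≤ 2 * N * P * m := Nat.mul_le_mul_right m hn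
    nlinarith
  have hb : j * m < m * P * (2 * N + 1) := by nlinarith
  refine ⟨w + (2 * ((n * m + t : ℕ) : ℤ) * M, 2 * ((j * m : ℕ) : ℤ) * M), ?_,
    hle.trans (le_of_eq ?_)⟩
  · have := hcopy _ ha _ hb
    unfold _root_.copyAt at this
    split_ifs at this
    · exact Or.inr this
    · exact Or.inl this
  · have : G (t + 1) = F (w + (2 * ((n * m + t : ℕ) : ℤ) * M, 2 * ((j * m : ℕ) : ℤ) * M) +
        (2 * (M : ℤ), 0)) := by
      simp only [hG, add_assoc, Prod.mk_add_mk, add_zero]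
      congr 3
      push_cast; ring
    rw [this]

/-! ### Iterating the construction -/

lemma PatchPair.iter_half_pos_and_isFramed {Q : PatchPair} {P : ℕ} {m N : ℕ → ℕ} (hP : 0 < P)
    (hQ : 0 < Q.half) (h1 : IsFramed Q.half Q.one) (h2 : IsFramed Q.half Q.two) :
    ∀ s, (∀ t < s, 0 < m t) → 0 < (Q.iter P m N s).half ∧
      IsFramed (Q.iter P m N s).half (Q.iter P m N s).one ∧
      IsFramed (Q.iter P m N s).half (Q.iter P m N s).two
  | 0, _ => ⟨hQ, h1, h2⟩
  | s + 1, hm => by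
    obtain ⟨h0, h1, h2⟩ :=
      iter_half_pos_and_isFramed hP hQ h1 h2 s fun t ht => hm t (ht.trans s.lt_succ_self)
    have hK : 0 < m s * P := Nat.mul_pos (hm s s.lt_succ_self) hP
    refine ⟨?_, h1.blockPatch h0 hK h2, h2.blockPatch h0 hK h1⟩
    change 0 < m s * P * (2 * N s + 1) * (Q.iter P m N s).half
    positivity

/-- Here the base point is the origin; all grid points lie in `D` by the `2ℤ`-property, since the
mesh `M / P` is even. -/
theorem forcesExpansion_of_admissible {L d d' lam : ℝ} {Ns P : ℕ} (hL : 1 ≤ L)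
    (hc : ∀ N, Ns ≤ N → AdmissibleConstants L d d' lam N P) :
    ForcesExpansion L d d' lam 1 Ns P := by
  intro D f _ hZ hf hs M N hM hN hdvd hcount
  obtain ⟨F, hF, hFf⟩ := hf.exists_isBiLipschitzSurjOn hL hs
  obtain ⟨hlam, hN0, hP0, hgap, hP, hsmall, -⟩ := hc N hN
  obtain ⟨c, rfl⟩ := hdvd
  have hc0 : 0 < c := by
    rcases Nat.eq_zero_or_pos c with rfl | h
    · omega
    · exact h
  have hPR : (0 : ℝ) < P := by exact_mod_cast hP0
  have hdiv : 2 * P * c / P = 2 * c := by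
    rw [show 2 * P * c = P * (2 * c) by ring, Nat.mul_div_cancel_left _ hP0]
  have hmem : ∀ a b : ℤ, ((a * (2 * c : ℕ), b) : ℤ × ℤ) ∈ D := fun a b =>
    hZ _ trivial (by push_cast; exact ⟨a * c, by ring⟩)
  have hM' : ((2 * P * c : ℕ) : ℝ) = P * (2 * c : ℕ) := by push_cast; ring
  have hcell : ∀ k : ℕ, cornerCount D (2 * P * c) (k + 1) =
      (D ∩ cell ((0, 0) + ((k : ℤ) * (P * (2 * c : ℕ)), 0)) (P * (2 * c))).ncard := by
    intro k
    unfold cornerCount cell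
    congr 4 <;> push_cast <;> simp only [Prod.mk_add_mk] <;> push_cast <;> ring
  have hexp := hF.exists_expanded_step (0, 0) (h := 2 * c) (lam := lam) (by positivity) hN0 hP0
    hP hgap hlam (by linarith) (fun n _ j _ => by simpa using hmem n (j * (2 * c : ℕ)))
    (fun q hq => by
      have h := hcount (2 * q + 1) (by omega) (by omega)
      rw [hcell, hcell, hM'] at h
      simpa using h)
  obtain ⟨n, hn, j, hj, hle⟩ := hexp
  have hmodP := Nat.mod_add_div n P
  have hx : ((((n / P + 1 : ℕ) : ℤ) - 1) * (2 * P * c : ℕ) + (n % P : ℕ) * (2 * c : ℕ) : ℤ) =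
      n * (2 * c : ℕ) := by
    have : (n : ℤ) = (n % P : ℕ) + P * (n / P : ℕ) := by exact_mod_cast hmodP.symm
    rw [this]
    push_cast
    ring
  have hxD := hmem n (j * (2 * c : ℕ))
  have hyD := hmem (n + 1) (j * (2 * c : ℕ))
  have hoD : ((0, 0) : ℤ × ℤ) ∈ D := by simpa using hmem 0 0
  have heD : ((2 * (2 * P * c : ℕ) * N, 0) : ℤ × ℤ) ∈ D := by
    have := hmem (2 * P * N) 0
    convert this using 2
    push_cast; ring
  refine ⟨⟨_, hxD⟩, ⟨_, hyD⟩, ⟨_, hoD⟩, ⟨_, heD⟩, n / P + 1, n % P, j, Nat.le_add_left 1 _, ?_,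
    Nat.mod_lt _ hP0, hj.le, ?_, ?_, rfl, rfl, ?_⟩
  · have : n / P < 2 * N := (Nat.div_lt_iff_lt_mul hP0).2 hn
    omega
  · rw [hdiv, hx]
  · rw [hdiv]
    ext
    · simp only [Prod.fst_add]; ring
    · simp
  · simp only [← hFf]
    simp only [Prod.mk_add_mk, zero_add] at hle
    have e1 : ((2 * P * c : ℕ) : ℝ) / P = (2 * c : ℕ) := by
      rw [hM']; field_simp
    have e2 : (2 * ((2 * P * c : ℕ) : ℝ) * N) = 2 * N * P * (2 * c : ℕ) := by
      rw [hM']; ring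
    have e3 : (2 * ((2 * P * c : ℕ) : ℤ) * N) = 2 * N * P * (2 * c : ℕ) := by
      push_cast; ring
    rw [e1, e2, e3]
    exact hle

lemma exists_admissibleConstants {L d d' : ℝ} (hd : d' < d) (hgap : d - d' ≤ 1) :
    ∃ (lam : ℝ) (Ns P : ℕ), 0 < lam ∧ 0 < Ns ∧ 0 < P ∧
      ∀ N, Ns ≤ N → AdmissibleConstants L d d' lam N P := by
  -- `P` is fixed first, to tell the densities apart; then `lam`, and last `N`, are adapted to it
  obtain ⟨P, hP⟩ := exists_nat_gt (32 * L ^ 2 / (d - d'))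
  have hdd : 0 < d - d' := by linarith
  have hPR : (0 : ℝ) < P := lt_of_le_of_lt (by positivity) hP
  have hP0 : 0 < P := by exact_mod_cast hPR
  set lam : ℝ := 1 / (32 * (P : ℝ) ^ 4) with hlam
  have hlam0 : 0 < lam := by positivity
  refine ⟨lam, 16 * P ^ 4 + ⌈(1 + 2 * lam) * L ^ 2 / (2 * lam)⌉₊, P, hlam0, by positivity, hP0,
    fun N hN => ⟨hlam0, lt_of_lt_of_le (by positivity) hN, hP0, hgap, ?_, ?_, ?_⟩⟩
  · rwa [div_lt_iff₀ hdd] at hP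
  · have h1 : 16 * (P : ℝ) ^ 4 ≤ N := by
      exact_mod_cast (Nat.le_add_right _ _).trans hN
    have h2 : 1 / (N : ℝ) ≤ 1 / (16 * (P : ℝ) ^ 4) := by gcongr
    have h3 : 2 * lam + 1 / (16 * (P : ℝ) ^ 4) = 1 / (8 * (P : ℝ) ^ 4) := by
      rw [hlam]; field_simp; norm_num
    linarith
  · have h1 : (⌈(1 + 2 * lam) * L ^ 2 / (2 * lam)⌉₊ : ℝ) ≤ N := by
      exact_mod_cast (Nat.le_add_left _ _).trans hN
    have h2 := (Nat.le_ceil ((1 + 2 * lam) * L ^ 2 / (2 * lam))).trans h1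
    rw [div_le_iff₀ (by positivity)] at h2
    linarith

theorem mainTheorem4 (L d₁' d₂' : ℝ) (hL : 1 ≤ L) (hd₁' : 0 < d₁') (hd : d₁' < d₂')
    (hd₂' : d₂' ≤ 1) :
    ∃ (lam : ℝ) (Ms Ns Ps : ℕ), 0 < lam ∧ 0 < Ms ∧ 0 < Ns ∧ 0 < Ps ∧
      ForcesExpansion L d₂' d₁' lam Ms Ns Ps ∧
      ∀ Q : PatchPair, 0 < Q.half → IsInitialPatch Q.half Q.one → IsInitialPatch Q.half Q.two →
        patchDensity Q.half Q.one < d₁' → d₂' < patchDensity Q.half Q.two →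
        ∀ l : ℕ, 1 ≤ l → L < (1 + lam) ^ l / L →
        ∀ m N : ℕ → ℕ,
          (∀ s < l, Odd (m s) ∧ Ms ≤ 2 * m s * Ps * (Q.iter Ps m N s).half ∧ Ns ≤ N s ∧
            patchDensity (Q.iter Ps m N (s + 1)).half (Q.iter Ps m N (s + 1)).one < d₁' ∧
            d₂' < patchDensity (Q.iter Ps m N (s + 1)).half (Q.iter Ps m N (s + 1)).two) →
          ∀ D : Set (ℤ × ℤ), IsDelone D → TwoZProperty Set.univ D →
            (ContainsPatch D (Q.iter Ps m N l).half (Q.iter Ps m N l).one ∨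
              ContainsPatch D (Q.iter Ps m N l).half (Q.iter Ps m N l).two) →
            ¬ ∃ f : D → ℤ × ℤ, IsBiLipschitzMap L f ∧ Function.Surjective f := by
  obtain ⟨lam, Ns, P, hlam, hNs, hP, hc⟩ :=
    exists_admissibleConstants (L := L) hd (by linarith)
  refine ⟨lam, 1, Ns, P, hlam, one_pos, hNs, hP, forcesExpansion_of_admissible hL hc, ?_⟩
  rintro Q hQ hQ1 hQ2 hd1 hd2 l - hl m N hmN D - - hD ⟨f, hf, hs⟩
  obtain ⟨F, hF, -⟩ := hf.exists_isBiLipschitzSurjOn hL hs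
  have hL0 : 0 < L := by linarith
  have hmpos : ∀ s < l, 0 < m s := fun s hs => (hmN s hs).1.pos
  have hframe : ∀ s ≤ l, _ := fun s hs => PatchPair.iter_half_pos_and_isFramed (N := N) hP hQ
    hQ1.isFramed hQ2.isFramed s fun t ht => hmpos t (lt_of_lt_of_le ht hs)
  have hdens : ∀ s ≤ l, patchDensity (Q.iter P m N s).half (Q.iter P m N s).one < d₁' ∧
      d₂' < patchDensity (Q.iter P m N s).half (Q.iter P m N s).two
    | 0, _ => ⟨hd1, hd2⟩
    | s + 1, hs => (hmN s hs).2.2.2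
  -- descend through the levels, gaining a factor `1 + lam` at each of them
  have key : ∀ t s : ℕ, s + t = l → ∃ w,
      (IsPlacedAt D (Q.iter P m N s).half (Q.iter P m N s).one w ∨
        IsPlacedAt D (Q.iter P m N s).half (Q.iter P m N s).two w) ∧
      (1 + lam) ^ t / L * (2 * (Q.iter P m N s).half) ≤
        euclNorm (F (w + (2 * ((Q.iter P m N s).half : ℤ), 0)) - F w) := by
    intro t
    induction t with
    | zero =>
      rintro s rfl
      obtain ⟨h0, h1, h2⟩ := hframe s le_rfl
      have hpl : ∃ w, IsPlacedAt D (Q.iter P m N s).half (Q.iter P m N s).one w ∨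
          IsPlacedAt D (Q.iter P m N s).half (Q.iter P m N s).two w := by
        rcases hD with hD | hD
        · obtain ⟨w, hw⟩ := hD.exists_isPlacedAt
          exact ⟨w, Or.inl hw⟩
        · obtain ⟨w, hw⟩ := hD.exists_isPlacedAt
          exact ⟨w, Or.inr hw⟩
      obtain ⟨w, hw⟩ := hpl
      have hwD : w ∈ D := hw.elim (·.corner_mem h1) (·.corner_mem h2)
      have hrD := hw.elim (·.right_corner_mem h1) (·.right_corner_mem h2)
      refine ⟨w, hw, ?_⟩
      have := hF.lower _ hrD _ hwD
      rw [add_sub_cancel_left, euclNorm_horizontal, abs_of_nonneg (by positivity)] at this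
      push_cast at this
      rw [pow_zero, div_mul_eq_mul_div, one_mul, div_le_iff₀ hL0]
      linarith
    | succ t ih =>
      intro s hst
      obtain ⟨w, hw, hE⟩ := ih (s + 1) (by omega)
      have hsl : s < l := by omega
      obtain ⟨h0, h1, h2⟩ := hframe s hsl.le
      obtain ⟨e1, e2⟩ := hdens s hsl.le
      have hcs := hc (N s) (hmN s hsl).2.2.1
      have hge : 1 / L ≤ (1 + lam) ^ t / L := by
        gcongr
        exact one_le_pow₀ (by linarith)
      have hpow : (1 + lam) ^ (t + 1) / L = (1 + lam) * ((1 + lam) ^ t / L) := by ring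
      rw [hpow]
      rcases hw with hw | hw
      · exact hF.exists_expanded_copy hcs h0 (hmpos s hsl) h1 h2 (Or.inl ⟨e1.le, e2.le⟩) hw hge hE
      · obtain ⟨w', hw', hE'⟩ := hF.exists_expanded_copy hcs h0 (hmpos s hsl) h2 h1
          (Or.inr ⟨e1.le, e2.le⟩) hw hge hE
        exact ⟨w', hw'.symm, hE'⟩
  -- the side of a copy of an initial patch would be expanded by more than `L`
  obtain ⟨w, hw, hE⟩ := key l 0 (zero_add l)
  obtain ⟨h0, h1, h2⟩ := hframe 0 (Nat.zero_le l)
  have hwD : w ∈ D := hw.elim (·.corner_mem h1) (·.corner_mem h2)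
  have hrD := hw.elim (·.right_corner_mem h1) (·.right_corner_mem h2)
  have hup := hF.upper _ hrD _ hwD
  rw [add_sub_cancel_left, euclNorm_horizontal, abs_of_nonneg (by positivity)] at hup
  push_cast at hup
  have hpos : (0 : ℝ) < 2 * (Q.iter P m N 0).half := by
    have : (0 : ℝ) < (Q.iter P m N 0).half := by exact_mod_cast h0
    positivity
  have := le_of_mul_le_mul_right (hE.trans hup) hpos
  linarith
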